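/- Let $\mathcal H$ and $\mathcal K$ be complex Hilbert spaces. Let $H_0$ be a self-adjoint operator on $\mathcal H$ with domain $\mathcal D$, let $F\colon\mathcal H\to\mathcal K$ be a densely defined closed operator with trivial kernel and dense range, let $J$ be a bounded self-adjoint operator on $\mathcal K$, and let $V=F^*JF$ on its natural domain $\{x\in\operatorname{dom}F : JFx\in\operatorname{dom}F^*\}$. Assume that $\mathcal D\subset\operatorname{dom}V$, that $H_s=H_0+sV$ (with domain $\mathcal D$) is self-adjoint for every $s\in\mathbb R$, and that for every $s\in\mathbb R$ and $z\in\mathbb C\setminus\mathbb R$ the operator $F(H_s-z)^{-1}F^*$ is bounded on $\operatorname{dom}F^*$ and its bounded extension $T_z(H_s)$ to $\mathcal K$ is compact. Put $A_z(s)=T_z(H_s)J$ and $B_z(s)=JT_z(H_s)$. A complex number $r$ is a resonance point corresponding to a non-real number $z$ if $(1+(r-s)A_z(s))u=0$ for some $s\in\mathbb R$ and some non-zero $u\in\mathcal K$. For complex $r$ and real $t$ put $$P_z(r)=\frac1{2\pi i}\oint(\sigma-A_z(t))^{-1}\,d\sigma,\qquad Q_z(r)=\frac1{2\pi i}\oint(\sigma-B_z(t))^{-1}\,d\sigma,$$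 where the integrals are over a small circle about $(t-r)^{-1}$ with no other point of the spectrum on or inside it. For a finite set $\Gamma\subset\mathbb C$ put $P_z(\Gamma)=\sum_{r\in\Gamma}P_z(r)$, $Q_z(\Gamma)=\sum_{r\in\Gamma}Q_z(r)$ and $\bar\Gamma=\{\bar r : r\in\Gamma\}$. The signature of a finite-rank self-adjoint operator $M$ is $\operatorname{sign}(M)=\operatorname{rank}M_+-\operatorname{rank}M_-$, where $M_\pm$ are its positive and negative parts. Let $\mathcal R$ be the class of finite-rank operators $A$ on $\mathcal K$ which have no non-zero real number in the spectrum and for which $A^2f=0$ implies $Af=0$; for $A\in\mathcal R$ the $R$-index is $N_+-N_-$, where $N_+$ and $N_-$ are the numbers of eigenvalues of $A$ in the open upper and lower half-planes, counted with algebraic multiplicities. Let $z$ be a non-real number and let $\Gamma$ be a finite set of resonance points corresponding to $z$. Then, for all real values of the parameters $t$ used to define $P_z(\Gamma)$ and $Q_{\bar z}(\bar\Gamma)$ and for every real $s$, the operator $Q_{\bar z}(\bar\Gamma)JP_z(\Gamma)$ is self-adjoint and of finite rank, the operator $\operatorname{Im}z\cdot A_z(s)P_z(\Gamma)$ belongs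 to $\mathcal R$, and the signature of $Q_{\bar z}(\bar\Gamma)JP_z(\Gamma)$ is equal to the $R$-index of $\operatorname{Im}z\cdot A_z(s)P_z(\Gamma)$. -/

import Mathlib

open scoped ComplexConjugate LinearPMap

noncomputable section

namespace ResonanceIndex

/-! ### Bounded operators: Riesz idempotents, signature, R-index -/

section BoundedOperators

variable {K : Type*} [NormedAddCommGroup K] [InnerProductSpace ℂ K] [CompleteSpace K]

/-- The Riesz idempotent `(2πi)⁻¹ ∮ (ζ - A)⁻¹ dζ` of `A` for an isolated point `σ` of its spectrum,
the contour being a small circle about `σ`. The integral (taken in the operator norm) does not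
depend on the radius `ε` as soon as there is no other spectrum of `A` on or inside the circle; so
"a small circle" is expressed as the limit `ε → 0+` of an eventually constant function. -/
def rieszIdempotent (A : K →L[ℂ] K) (σ : ℂ) : K →L[ℂ] K :=
  Filter.limUnder (nhdsWithin (0 : ℝ) (Set.Ioi 0)) fun ε : ℝ =>
    (2 * (Real.pi : ℂ) * Complex.I)⁻¹ • ∮ ζ in C(σ, ε), resolvent A ζ

/-- Operators with finite-dimensional range. -/
def IsFiniteRank (A : K →L[ℂ] K) : Prop :=
  FiniteDimensional ℂ (LinearMap.range (A : K →ₗ[ℂ] K))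

/-- The rank of an operator (used for finite-rank operators only). -/
def rank (A : K →L[ℂ] K) : ℕ :=
  Module.finrank ℂ (LinearMap.range (A : K →ₗ[ℂ] K))

/-- The signature `rank A₊ - rank A₋` of a finite-rank self-adjoint operator; `A⁺` and `A⁻` are the
positive and negative parts of `A` in the sense of the functional calculus. -/
def signature (A : K →L[ℂ] K) : ℤ :=
  (rank A⁺ : ℤ) - (rank A⁻ : ℤ)

/-- The algebraic multiplicity `dim {u | ∃ k, (A - μ)ᵏ u = 0}`. -/
def algMult (A : K →L[ℂ] K) (μ : ℂ) : ℕ :=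
  Module.finrank ℂ (Module.End.maxGenEigenspace (A : Module.End ℂ K) μ)

/-- The class of finite-rank operators which have no non-zero real numbers in the spectrum and for
which `A² f = 0` implies `A f = 0`. -/
structure IsClassR (A : K →L[ℂ] K) : Prop where
  finiteRank : IsFiniteRank A
  real_spectrum : ∀ x : ℝ, (x : ℂ) ∈ spectrum ℂ A → x = 0
  ker_sq : ∀ f : K, A (A f) = 0 → A f = 0

/-- The `R`-index `N₊ - N₋`, where `N₊` and `N₋` are the numbers of eigenvalues in the open upper
and lower half-planes, counted with algebraic multiplicities. -/
def rIndex (A : K →L[ℂ] K) : ℤ :=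
  (∑ᶠ (μ : ℂ) (_ : 0 < μ.im), (algMult A μ : ℤ)) - ∑ᶠ (μ : ℂ) (_ : μ.im < 0), (algMult A μ : ℤ)

end BoundedOperators

/-! ### Unbounded operators -/

section UnboundedOperators

variable {H K : Type*} [NormedAddCommGroup H] [InnerProductSpace ℂ H] [CompleteSpace H]
  [NormedAddCommGroup K] [InnerProductSpace ℂ K] [CompleteSpace K]

/-- The resolvent `R_z(T) = (T - z)⁻¹`, a map from `H` to the domain of `T`
(the inverse of `T - z` whenever `T - z` maps the domain of `T` bijectively onto `H`). -/
def resolventMap (T : H →ₗ.[ℂ] H) (z : ℂ) : H → T.domain :=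
  Function.invFun fun x : T.domain => T x - z • (x : H)

/-- The operator `F* J F` on its natural domain `{x ∈ dom F | J F x ∈ dom F*}`. -/
def sandwich (F : H →ₗ.[ℂ] K) (J : K →L[ℂ] K) : H →ₗ.[ℂ] H where
  domain :=
    { carrier := {x | ∃ hx : x ∈ F.domain, J (F ⟨x, hx⟩) ∈ F†.domain}
      add_mem' := by
        rintro x y ⟨hx, hx'⟩ ⟨hy, hy'⟩
        refine ⟨F.domain.add_mem hx hy, ?_⟩
        have h : F ⟨x + y, F.domain.add_mem hx hy⟩ = F ⟨x, hx⟩ + F ⟨y, hy⟩ :=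
          F.map_add ⟨x, hx⟩ ⟨y, hy⟩
        rw [h, map_add]
        exact F†.domain.add_mem hx' hy'
      zero_mem' := by
        refine ⟨F.domain.zero_mem, ?_⟩
        have h : F ⟨0, F.domain.zero_mem⟩ = 0 := F.map_zero
        rw [h, map_zero]
        exact F†.domain.zero_mem
      smul_mem' := by
        rintro c x ⟨hx, hx'⟩
        refine ⟨F.domain.smul_mem c hx, ?_⟩
        have h : F ⟨c • x, F.domain.smul_mem c hx⟩ = c • F ⟨x, hx⟩ := F.map_smul c ⟨x, hx⟩
        rw [h, map_smul]
        exact F†.domain.smul_mem c hx' }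
  toFun :=
    { toFun := fun x => F† ⟨J (F ⟨(x : H), x.2.choose⟩), x.2.choose_spec⟩
      map_add' := by
        intro x y
        rw [← LinearPMap.map_add]
        congr 1
        apply Subtype.ext
        change J (F ⟨(x : H) + y, _⟩) = J (F ⟨x, _⟩) + J (F ⟨y, _⟩)
        rw [← map_add, ← LinearPMap.map_add]
        rfl
      map_smul' := by
        intro c x
        rw [RingHom.id_apply, ← LinearPMap.map_smul]
        congr 1
        apply Subtype.ext
        change J (F ⟨c • (x : H), _⟩) = c • J (F ⟨x, _⟩)
        rw [← map_smul, ← LinearPMap.map_smul]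
        rfl }

end UnboundedOperators

/-- The initial operator `H₀` on the main space `H`, the rigging operator `F` from the main space `H`
to the auxiliary space `K`, and the operator `J` on `K`. -/
structure PerturbationData (H K : Type*)
    [NormedAddCommGroup H] [InnerProductSpace ℂ H] [CompleteSpace H]
    [NormedAddCommGroup K] [InnerProductSpace ℂ K] [CompleteSpace K] where
  /-- the initial operator -/
  H₀ : H →ₗ.[ℂ] H
  /-- the rigging operator -/
  F : H →ₗ.[ℂ] K
  /-- the middle factor of the perturbation -/
  J : K →L[ℂ] K

namespace PerturbationData

variable {H K : Type*} [NormedAddCommGroup H] [InnerProductSpace ℂ H] [CompleteSpace H]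
  [NormedAddCommGroup K] [InnerProductSpace ℂ K] [CompleteSpace K]

/-- The perturbation `V = F* J F`. -/
def V (D : PerturbationData H K) : H →ₗ.[ℂ] H :=
  sandwich D.F D.J

/-- The operator `H_s = H₀ + s V` on `dom H₀ ∩ dom V`. -/
def Hs (D : PerturbationData H K) (s : ℝ) : H →ₗ.[ℂ] H :=
  D.H₀ + (s : ℂ) • D.V

theorem mem_domain_F (D : PerturbationData H K) {s : ℝ} (x : (D.Hs s).domain) :
    (x : H) ∈ D.F.domain :=
  x.2.2.choose

/-- The unbounded operator `F R_z(H_s) F*`, defined on the domain of `F*`. -/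
def sandwichedResolvent₀ (D : PerturbationData H K) (z : ℂ) (s : ℝ) (φ : D.F†.domain) : K :=
  D.F ⟨(resolventMap (D.Hs s) z (D.F† φ) : H), D.mem_domain_F _⟩

/-- The bounded operator `T` extends `F R_z(H_s) F*` from the domain of `F*` to the whole of `K`. -/
def ExtendsSandwichedResolvent (D : PerturbationData H K) (z : ℂ) (s : ℝ) (T : K →L[ℂ] K) : Prop :=
  ∀ φ : D.F†.domain, T (φ : K) = D.sandwichedResolvent₀ z s φ

open Classical in
/-- The sandwiched resolvent `T_z(H_s)`: the bounded extension of `F R_z(H_s) F*` to `K`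
(unique, since the domain of `F*` is dense). -/
def T (D : PerturbationData H K) (z : ℂ) (s : ℝ) : K →L[ℂ] K :=
  if h : ∃ T : K →L[ℂ] K, D.ExtendsSandwichedResolvent z s T then h.choose else 0

/-- The standing assumptions: all `H_s` are self-adjoint on the common domain `dom H₀`, which is
contained in `dom V` (so also in `dom F`); `F` is a rigging operator, i.e. densely defined and closed
with trivial kernel and cokernel; `J` is self-adjoint; and for non-real `z` the operator
`F R_z(H_s) F*` is bounded with compact extension to `K`. -/
structure Admissible (D : PerturbationData H K) : Prop where
  selfAdjoint_H₀ : IsSelfAdjoint D.H₀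
  dense_F : Dense (D.F.domain : Set H)
  closed_F : D.F.IsClosed
  ker_F : ∀ x : D.F.domain, D.F x = 0 → x = 0
  coker_F : Dense (Set.range D.F)
  selfAdjoint_J : IsSelfAdjoint D.J
  domain_le : D.H₀.domain ≤ D.V.domain
  selfAdjoint_Hs : ∀ s : ℝ, IsSelfAdjoint (D.Hs s)
  compact_T : ∀ (z : ℂ) (s : ℝ), z.im ≠ 0 →
    ∃ T : K →L[ℂ] K, D.ExtendsSandwichedResolvent z s T ∧ IsCompactOperator T

/-- `A_z(s) = T_z(H_s) J`. -/
def A (D : PerturbationData H K) (z : ℂ) (s : ℝ) : K →L[ℂ] K :=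
  D.T z s ∘L D.J

/-- `B_z(s) = J T_z(H_s)`. -/
def B (D : PerturbationData H K) (z : ℂ) (s : ℝ) : K →L[ℂ] K :=
  D.J ∘L D.T z s

/-- `r` is a resonance point corresponding to `z`: the equation `(1 + (r - s) A_z(s)) u = 0` has a
non-zero solution (for non-real `z` this property does not depend on the real number `s`). -/
def IsResonancePoint (D : PerturbationData H K) (z r : ℂ) : Prop :=
  ∃ (s : ℝ) (u : K), u ≠ 0 ∧ u + (r - s) • D.A z s u = 0

/-- The idempotent `P_z(r)`: the Riesz idempotent of `A_z(t)` for the eigenvalue `(t - r)⁻¹`. -/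
def P (D : PerturbationData H K) (z : ℂ) (t : ℝ) (r : ℂ) : K →L[ℂ] K :=
  rieszIdempotent (D.A z t) (t - r)⁻¹

/-- The idempotent `Q_z(r)`: the Riesz idempotent of `B_z(t)` for the eigenvalue `(t - r)⁻¹`. -/
def Q (D : PerturbationData H K) (z : ℂ) (t : ℝ) (r : ℂ) : K →L[ℂ] K :=
  rieszIdempotent (D.B z t) (t - r)⁻¹

/-- `P_z(Γ) = ∑ P_z(r)`, the sum over `r ∈ Γ`. -/
def PSet (D : PerturbationData H K) (z : ℂ) (t : ℝ) (Γ : Finset ℂ) : K →L[ℂ] K :=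
  ∑ r ∈ Γ, D.P z t r

/-- `Q_z(Γ) = ∑ Q_z(r)`, the sum over `r ∈ Γ`. -/
def QSet (D : PerturbationData H K) (z : ℂ) (t : ℝ) (Γ : Finset ℂ) : K →L[ℂ] K :=
  ∑ r ∈ Γ, D.Q z t r

end PerturbationData

end ResonanceIndex

end

/-! Write $P=P_z(\Gamma)$ and $N=\operatorname{Im}z\cdot A_z(s)P$. Since $T_z(H_s)^*=T_{\bar
z}(H_s)$, the adjoint of $A_z(t)$ is $B_{\bar z}(t)$, so $Q_{\bar z}(\bar\Gamma)=P^*$. The operator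
in question is thus $P^*JP$, and its signature is that of the Hermitian form $\langle u,Ju\rangle$
on the finite-dimensional range of $P$.

On that range $N$ is strictly dissipative for the form: $\langle
u,JNu\rangle=\operatorname{Im}z\,\langle Ju,T_z(H_s)Ju\rangle$ has positive imaginary part for
$u\ne0$. Indeed $\operatorname{Im}z\cdot\operatorname{Im}\langle\varphi,T_z(H_s)\varphi\rangle$ is
positive unless $T_z(H_s)\varphi=0$ (`Admissible.im_inner_T_pos`), and $A_z(s)$ is injective on the
range of $P$. Dissipativity excludes real eigenvalues of $N$ there. It also makes the form positive
on the spectral subspace of the upper half-plane and negative on that of the lower one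
(`re_inner_pos_of_dissipative`). The dimensions of these two subspaces are the terms of the
$R$-index and, by the law of inertia (`rank_posPart_eq`), the ranks of the positive and negative
parts of $P^*JP$.

The parameters $s$, $t$, $t'$ may differ because, by the second resolvent identity, $A_z(t)$ is a
Möbius function of $A_z(0)$, so its Riesz idempotent at $(t-r)^{-1}$ does not depend on $t$
(`Admissible.exists_isFitting`). The idempotents are handled through an algebraic Fitting
decomposition, which exists for compact operators at non-zero points; the contour integral is
evaluated once, in `IsFitting.rieszIdempotent_eq`. -/

open scoped ComplexConjugate LinearPMap

noncomputable section

namespace ResonanceIndex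

/-! ### Fitting decompositions in a ring -/

/-- `P` is the idempotent of a Fitting decomposition of `N`: on the range of `P` the element `N` is
nilpotent of order `n`, and on the range of `1 - P` it is invertible with inverse `S`. -/
structure IsFitting {R : Type*} [Ring R] (N P S : R) (n : ℕ) : Prop where
  idem : P * P = P
  comm : N * P = P * N
  nil : N ^ n * P = 0
  mul_inv : N * S = 1 - P
  inv_mul : S * N = 1 - P
  inv_proj : S * P = 0
  proj_inv : P * S = 0

/-- A strongly `π`-regular element of a ring has a Fitting decomposition. -/
theorem exists_isFitting {R : Type*} [Ring R] {N G W : R} {n : ℕ}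
    (hG : N ^ (n + 1) = G * (N ^ (n + 1) * N ^ (n + 1)))
    (hW : N ^ (n + 1) = N ^ (n + 1) * N ^ (n + 1) * W) :
    ∃ P S : R, IsFitting N P S (n + 1) := by
  set U := N ^ (n + 1) with hU
  have hNU : N * U = U * N := by rw [hU, ← pow_succ, ← pow_succ']
  -- The two forms $GU=UW$ make $p$ a two-sided identity for $U$. The element $S$ below inverts $U$
  -- in the corner $pRp$.
  obtain ⟨p, hp⟩ : ∃ p, p = G * U := ⟨_, rfl⟩
  have hp' : p = U * W := by
    calc p = G * (U * U * W) := by rw [hp, ← hW]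
      _ = G * (U * U) * W := by noncomm_ring
      _ = U * W := by rw [← hG]
  have hpU : p * U = U := by rw [hp, mul_assoc, ← hG]
  have hUp : U * p = U := by rw [hp', ← mul_assoc, ← hW]
  have hpp : p * p = p := by
    calc p * p = p * U * W := by rw [mul_assoc, ← hp']
      _ = p := by rw [hpU, ← hp']
  obtain ⟨S, hS⟩ : ∃ S, S = p * W := ⟨_, rfl⟩
  have hS' : S = G * p := by rw [hS, hp, mul_assoc, ← hp', hp]
  have hUS : U * S = p := by rw [hS, ← mul_assoc, hUp, ← hp']
  have hSU : S * U = p := by rw [hS', mul_assoc, hpU, ← hp]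
  have hpS : p * S = S := by rw [hS, ← mul_assoc, hpp]
  have hSp : S * p = S := by rw [hS', mul_assoc, hpp]
  have hNp : N * p = p * N := by
    have h1 : N * p = p * N * p := by
      calc N * p = N * U * S := by rw [mul_assoc, hUS]
        _ = p * U * N * S := by rw [hpU, hNU]
        _ = p * (N * U) * S := by rw [hNU]; noncomm_ring
        _ = p * N * p := by rw [← hUS]; noncomm_ring
    have h2 : p * N = p * N * p := by
      calc p * N = S * (N * U) := by rw [hNU, ← mul_assoc, hSU]
        _ = S * (N * U) * p := by rw [mul_assoc, mul_assoc, hUp]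
        _ = p * N * p := by rw [hNU, ← mul_assoc, hSU]
    rw [h1, ← h2]
  have hNS : N * S = S * N := by
    calc N * S = p * N * S := by rw [← hNp, mul_assoc, hpS]
      _ = S * (U * N) * S := by rw [← hSU]; noncomm_ring
      _ = S * (N * (U * S)) := by rw [← hNU]; noncomm_ring
      _ = S * p * N := by rw [hUS, hNp]; noncomm_ring
      _ = S * N := by rw [hSp]
  have hc : Commute S (N ^ n) := Commute.pow_right hNS.symm n
  -- The nilpotent part lives on $1-p$. On $p$ the inverse of $N$ is $N^nS$, because $N^{n+1}S=p$.
  refine ⟨1 - p, N ^ n * S, ?_, ?_, ?_, ?_, ?_, ?_, ?_⟩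
  · rw [mul_sub, sub_mul (1 : R) p p, hpp]; noncomm_ring
  · rw [mul_sub, sub_mul, hNp]; noncomm_ring
  · rw [← hU, mul_sub, hUp]; noncomm_ring
  · rw [← mul_assoc, ← pow_succ', ← hU, hUS]; noncomm_ring
  · rw [← hc.eq, mul_assoc, ← pow_succ, ← hU, hSU]; noncomm_ring
  · rw [mul_assoc, mul_sub, hSp]; noncomm_ring
  · rw [← hc.eq, ← mul_assoc, sub_mul, hpS]; noncomm_ring

/-! ### Riesz theory of compact operators -/

section Compact

variable {K : Type*} [NormedAddCommGroup K] [InnerProductSpace ℂ K] [CompleteSpace K]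

open ContinuousLinearMap in
/-- `A` is a compact operator with compact adjoint. -/
def BiCompact (A : K →L[ℂ] K) : Prop :=
  IsCompactOperator A ∧ IsCompactOperator (adjoint A)

open ContinuousLinearMap in
/-- Powers of a non-zero scalar plus a compact operator are of the same form. -/
theorem exists_biCompact_pow {A : K →L[ℂ] K} (hA : BiCompact A) (σ : ℂ) (n : ℕ) :
    ∃ C : K →L[ℂ] K, BiCompact C ∧ (A - σ • 1) ^ n = (-σ) ^ n • 1 + C := by
  induction n with
  | zero =>
    refine ⟨0, ⟨?_, ?_⟩, by simp⟩
    · exact isCompactOperator_zero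
    · rw [map_zero]; exact isCompactOperator_zero
  | succ n ih =>
    obtain ⟨C, ⟨hC, hC'⟩, h⟩ := ih
    have h2 : IsCompactOperator (adjoint A * adjoint C) := hC'.clm_comp (adjoint A)
    have h3 : adjoint (C * A) = adjoint A * adjoint C := adjoint_comp C A
    refine ⟨(-σ) ^ n • A + C * A - σ • C, ⟨?_, ?_⟩, ?_⟩
    · exact ((hA.1.smul _).add (hC.comp_clm A)).sub (hC.smul σ)
    · rw [map_sub, map_add, LinearIsometryEquiv.map_smulₛₗ, LinearIsometryEquiv.map_smulₛₗ, h3]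
      exact ((hA.2.smul _).add h2).sub (hC'.smul (conj σ))
    · rw [pow_succ, h]
      ext x
      simp [pow_succ]
      module

/-- The kernel of a non-zero scalar plus a compact operator is finite-dimensional. -/
theorem finiteDimensional_ker_smul_add {C : K →L[ℂ] K} (hC : IsCompactOperator C) {c : ℂ}
    (hc : c ≠ 0) : FiniteDimensional ℂ (LinearMap.ker (c • 1 + C : K →L[ℂ] K).toLinearMap) := by
  set W := LinearMap.ker (c • 1 + C : K →L[ℂ] K).toLinearMap
  have hW : ∀ v ∈ W, (C : K →ₗ[ℂ] K) v = -c • v := fun v hv => by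
    have : c • v + C v = 0 := hv
    simpa using (eq_neg_of_add_eq_zero_right this)
  have hCW : ∀ v ∈ W, (C : K →ₗ[ℂ] K) v ∈ W := fun v hv => by
    rw [hW v hv]; exact W.smul_mem _ hv
  have h1 : IsCompactOperator ((C : K →ₗ[ℂ] K).restrict hCW) :=
    IsCompactOperator.restrict' (f := (C : K →ₗ[ℂ] K)) hC hCW
  have h2 := h1.smul (-c)⁻¹
  refine FiniteDimensional.of_isCompactOperator_id ?_ (𝕜 := ℂ)
  have h3 : ((-c)⁻¹ • ⇑((C : K →ₗ[ℂ] K).restrict hCW) : W → W) = id := by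
    funext v
    apply Subtype.ext
    have := hW v v.2
    simp only [Pi.smul_apply, LinearMap.restrict_apply, id, Submodule.coe_smul]
    rw [this, inv_smul_smul₀ (neg_ne_zero.2 hc)]
  rwa [h3] at h2

omit [CompleteSpace K] in
/-- The kernels of the powers of `A - σ` become stationary. -/
theorem exists_ker_pow_eq {A : K →L[ℂ] K} (hA : IsCompactOperator A) {σ : ℂ} (hσ : σ ≠ 0) :
    ∃ k : ℕ, LinearMap.ker ((A - σ • 1 : K →L[ℂ] K).toLinearMap ^ k) =
      LinearMap.ker ((A - σ • 1 : K →L[ℂ] K).toLinearMap ^ (k + 1)) := by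
  by_contra! hne
  set N : K →L[ℂ] K := A - σ • 1 with hN
  let V : ℕ → Submodule ℂ K := fun k => LinearMap.ker (N.toLinearMap ^ k)
  have hmono : Monotone V := monotone_nat_of_le_succ fun k => by
    intro x hx
    have : (N.toLinearMap ^ k) x = 0 := hx
    change (N.toLinearMap ^ (k + 1)) x = 0
    rw [pow_succ', Module.End.mul_apply, this, map_zero]
  have hNV : ∀ k x, x ∈ V (k + 1) → N x ∈ V k := fun k x hx => by
    have : (N.toLinearMap ^ (k + 1)) x = 0 := hx
    rwa [pow_succ, Module.End.mul_apply] at this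
  have hclosed : ∀ k, IsClosed (V k : Set K) := fun k => by
    have : (N.toLinearMap ^ k) = (N ^ k).toLinearMap := by
      rw [ContinuousLinearMap.toLinearMap_pow]
    change IsClosed (LinearMap.ker (N.toLinearMap ^ k) : Set K)
    rw [this]
    exact (N ^ k).isClosed_ker
  -- Were the kernels strictly increasing, Riesz's lemma would give bounded vectors at distance at
  -- least 1 from the preceding kernel; their images under $A$ turn out to be $|\sigma|$-separated,
  -- against compactness. The bound 3 is any number above the norm of the scalar 2.
  have hx : ∀ k, ∃ x ∈ V (k + 1), ‖x‖ ≤ 3 ∧ ∀ y ∈ V k, 1 ≤ ‖x - y‖ := fun k => by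
    have hlt : ¬ V (k + 1) ≤ V k := fun h => hne k (le_antisymm (hmono k.le_succ) h)
    obtain ⟨v, hv, hv'⟩ := SetLike.not_le_iff_exists.1 hlt
    have h1 : IsClosed ((V k).comap (V (k + 1)).subtype : Set (V (k + 1))) :=
      (hclosed k).preimage continuous_subtype_val
    obtain ⟨⟨x, hx⟩, hx1, hx2⟩ := riesz_lemma_of_norm_lt (c := (2 : ℂ)) (R := 3) (by norm_num)
      (by norm_num) h1 ⟨⟨v, hv⟩, hv'⟩
    exact ⟨x, hx, hx1, fun y hy => hx2 ⟨y, hmono k.le_succ hy⟩ hy⟩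
  choose x hxV hx3 hx1 using hx
  have hsep : ∀ j k, j < k → ‖σ‖ ≤ ‖A (x k) - A (x j)‖ := fun j k hjk => by
    let y : K := -(σ⁻¹ • (N (x k) - N (x j) - σ • x j))
    have hy : y ∈ V k := by
      refine neg_mem (Submodule.smul_mem _ _ (sub_mem (sub_mem (hNV k _ (hxV k)) ?_) ?_))
      · exact hmono hjk.le (hNV j _ (hxV j))
      · exact Submodule.smul_mem _ _ (hmono (Nat.succ_le_of_lt hjk) (hxV j))
    have : A (x k) - A (x j) = σ • (x k - y) := by
      simp only [y, hN, smul_sub, smul_neg, smul_inv_smul₀ hσ]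
      simp
      module
    rw [this, norm_smul]
    exact le_mul_of_one_le_right (norm_nonneg _) (hx1 k y hy)
  obtain ⟨Q, hQ, hQ'⟩ := hA.image_closedBall_subset_compact (f := (A : K →ₗ[ℂ] K)) 3
  obtain ⟨y, -, ψ, hψ, hψy⟩ := hQ.tendsto_subseq (x := fun n => A (x n))
    (fun n ↦ hQ' ⟨x n, by simpa using hx3 n, rfl⟩)
  replace hψy := hψy.cauchySeq
  rw [Metric.cauchySeq_iff'] at hψy
  obtain ⟨m, hm⟩ := hψy ‖σ‖ (by positivity)
  have h1 : ‖A (x (ψ (m + 1))) - A (x (ψ m))‖ < ‖σ‖ := by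
    simpa [dist_eq_norm_sub] using hm (m + 1) (by lia)
  exact h1.not_ge (hsep _ _ (hψ (Nat.lt_succ_self m)))

open ContinuousLinearMap in
/-- A non-zero scalar plus a compact operator has a left inverse modulo its kernel. -/
theorem exists_left_inverse_mod_ker {C : K →L[ℂ] K} (hC : BiCompact C) {c : ℂ} (hc : c ≠ 0) :
    ∃ E Q : K →L[ℂ] K, E * (c • 1 + C) = 1 - Q ∧ ∀ x, (c • 1 + C : K →L[ℂ] K) (Q x) = 0 := by
  set U : K →L[ℂ] K := c • 1 + C with hU
  set W := LinearMap.ker U.toLinearMap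
  have : FiniteDimensional ℂ W := finiteDimensional_ker_smul_add hC.1 hc
  let Q : K →L[ℂ] K := W.starProjection
  have hQmem : ∀ x, Q x ∈ W := fun x => Submodule.starProjection_apply_mem _ x
  have hQc : IsCompactOperator Q := by
    have : ProperSpace W := FiniteDimensional.proper_rclike ℂ W
    have h : IsCompactOperator W.subtypeL :=
      isCompactOperator_of_locallyCompactSpace_rng W.subtypeL
    exact h.comp_clm W.orthogonalProjectionOnto
  have hUQ : U * Q = 0 := by ext x; exact hQmem x
  have hQadj : adjoint Q = Q := isSelfAdjoint_starProjection W
  -- $U^*U+Q$, with $Q$ the orthogonal projection onto $\ker U$, is injective and equals $|c|^2$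
  -- plus a compact operator. By the Fredholm alternative it is invertible, and its inverse times
  -- $U^*$ is the required $E$.
  let Ds : K →L[ℂ] K := adjoint U * U + Q
  let C' : K →L[ℂ] K := conj c • C + adjoint C * (c • 1 + C) + Q
  have hC' : IsCompactOperator C' := ((hC.1.smul _).add (hC.2.comp_clm _)).add hQc
  let μ : ℂ := -(conj c * c)
  have hμ : μ ≠ 0 := neg_ne_zero.2 (mul_ne_zero (by simpa using hc) hc)
  have hDs : Ds = C' - μ • 1 := by
    simp only [Ds, C', μ, hU, map_add, LinearIsometryEquiv.map_smulₛₗ]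
    have : adjoint (1 : K →L[ℂ] K) = 1 := adjoint_id
    rw [this]
    ext x
    simp
    module
  have hev : ¬ Module.End.HasEigenvalue (C' : Module.End ℂ K) μ := fun h => by
    obtain ⟨v, hv⟩ := h.exists_hasEigenvector
    have h1 : C' v = μ • v := hv.apply_eq_smul
    have h2 : Ds v = 0 := by rw [hDs]; simp [h1]
    have h3 : inner ℂ v (Ds v) = ((‖U v‖ ^ 2 + ‖Q v‖ ^ 2 : ℝ) : ℂ) := by
      have hQ2 : Q v = Q (Q v) := by
        have := W.isIdempotentElem_starProjection
        exact (congrArg (fun T : K →L[ℂ] K => T v) this).symm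
      have h4 : inner ℂ v (Q v) = inner ℂ (Q v) (Q v) := by
        conv_lhs => rw [hQ2, ← hQadj, adjoint_inner_right, hQadj]
      have h5 : Ds v = adjoint U (U v) + Q v := rfl
      rw [h5, inner_add_right, adjoint_inner_right, h4]
      rw [inner_self_eq_norm_sq_to_K, inner_self_eq_norm_sq_to_K]
      push_cast; rfl
    rw [h2, inner_zero_right] at h3
    have h5 : ‖U v‖ ^ 2 + ‖Q v‖ ^ 2 = 0 := by exact_mod_cast h3.symm
    have h6 : ‖U v‖ = 0 := by nlinarith [sq_nonneg ‖U v‖, sq_nonneg ‖Q v‖]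
    have h7 : ‖Q v‖ = 0 := by nlinarith [sq_nonneg ‖U v‖, sq_nonneg ‖Q v‖]
    have h8 : v ∈ W := norm_eq_zero.1 h6
    have h9 : Q v = v := Submodule.starProjection_eq_self_iff.2 h8
    exact hv.2 (by rw [← h9]; exact norm_eq_zero.1 h7)
  have hunit : IsUnit Ds := by
    have := (hC'.hasEigenvalue_or_mem_resolventSet hμ).resolve_left hev
    rw [spectrum.mem_resolventSet_iff, ← IsUnit.neg_iff] at this
    convert this using 1
    rw [hDs, Algebra.algebraMap_eq_smul_one]; abel
  obtain ⟨D, hD⟩ := hunit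
  have hQD : Ds * Q = Q := by
    have := W.isIdempotentElem_starProjection
    simp only [Ds, add_mul, mul_assoc, hUQ, mul_zero, zero_add]
    exact this
  refine ⟨(D⁻¹ : (K →L[ℂ] K)ˣ) * adjoint U, Q, ?_, fun x => hQmem x⟩
  have h1 : adjoint U * U = D * (1 - Q) := by
    rw [hD, mul_sub, hQD, mul_one]; simp [Ds]
  rw [mul_assoc, h1, ← mul_assoc, Units.inv_mul, one_mul]

theorem BiCompact.adjoint {A : K →L[ℂ] K} (hA : BiCompact A) :
    BiCompact (ContinuousLinearMap.adjoint A) :=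
  ⟨hA.2, by rw [ContinuousLinearMap.adjoint_adjoint]; exact hA.1⟩

/-- From some power on, `A - σ` satisfies `Nᵐ = G N²ᵐ`. -/
theorem exists_pow_eq_mul_sq {A : K →L[ℂ] K} (hA : BiCompact A) {σ : ℂ} (hσ : σ ≠ 0) :
    ∃ k : ℕ, ∀ m ≥ k, ∃ G : K →L[ℂ] K,
      (A - σ • 1) ^ m = G * ((A - σ • 1) ^ m * (A - σ • 1) ^ m) := by
  obtain ⟨k, hk⟩ := exists_ker_pow_eq hA.1 hσ
  refine ⟨k, fun m hm => ?_⟩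
  set N : K →L[ℂ] K := A - σ • 1 with hN
  obtain ⟨C, hC, h⟩ := exists_biCompact_pow hA σ (m + m)
  obtain ⟨E, Q, hE, hQ⟩ := exists_left_inverse_mod_ker hC
    (c := (-σ) ^ (m + m)) (pow_ne_zero _ (neg_ne_zero.2 hσ))
  rw [← h, ← hN, pow_add] at hE hQ
  -- $N^mE\,N^{2m}=N^m(1-Q)$, and $N^mQ=0$ because $Q$ maps into $\ker N^{2m}=\ker N^m$.
  refine ⟨N ^ m * E, ?_⟩
  rw [mul_assoc, hE, mul_sub, mul_one]
  have hconst : ∀ j, LinearMap.ker (N.toLinearMap ^ k) = LinearMap.ker (N.toLinearMap ^ (k + j)) :=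
    fun j => Module.End.ker_pow_constant hk j
  have : N ^ m * Q = 0 := by
    ext x
    have h1 : Q x ∈ LinearMap.ker (N.toLinearMap ^ (k + (m + m - k))) := by
      rw [show k + (m + m - k) = m + m by lia]
      have := hQ x
      rw [← pow_add] at this
      rw [← ContinuousLinearMap.toLinearMap_pow]
      exact this
    rw [← hconst, hconst (m - k), show k + (m - k) = m by lia,
      ← ContinuousLinearMap.toLinearMap_pow] at h1
    exact h1
  rw [this, sub_zero]

theorem adjoint_sub_smul_one_pow (A : K →L[ℂ] K) (σ : ℂ) (m : ℕ) :
    star ((A - σ • 1) ^ m) = (ContinuousLinearMap.adjoint A - conj σ • 1) ^ m := by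
  rw [star_pow, star_sub, star_smul, star_one]; rfl

/-- The Riesz decomposition of a compact operator (with compact adjoint) at a non-zero number. -/
theorem exists_isFitting_of_biCompact {A : K →L[ℂ] K} (hA : BiCompact A) {σ : ℂ} (hσ : σ ≠ 0) :
    ∃ (n : ℕ) (P S : K →L[ℂ] K), IsFitting (A - σ • 1) P S n ∧ IsFiniteRank P := by
  obtain ⟨k, hk⟩ := exists_pow_eq_mul_sq hA hσ
  -- The right-hand identity for $A-\sigma$ is the adjoint of the left-hand one for
  -- $A^*-\bar\sigma$; compactness of $A^*$ enters here.
  obtain ⟨l, hl⟩ := exists_pow_eq_mul_sq hA.adjoint (σ := conj σ) (by simpa using hσ)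
  obtain ⟨G, hG⟩ := hk (max k l + 1) (by lia)
  obtain ⟨W, hW⟩ := hl (max k l + 1) (by lia)
  have hW' := congrArg star hW
  rw [← adjoint_sub_smul_one_pow, star_mul, star_mul, star_star] at hW'
  obtain ⟨P, S, hP⟩ := exists_isFitting hG hW'
  refine ⟨_, P, S, hP, ?_⟩
  obtain ⟨C, hC, h⟩ := exists_biCompact_pow hA σ (max k l + 1)
  have := finiteDimensional_ker_smul_add hC.1 (c := (-σ) ^ (max k l + 1))
    (pow_ne_zero _ (neg_ne_zero.2 hσ))
  refine Submodule.finiteDimensional_of_le (S₂ := LinearMap.ker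
    ((-σ) ^ (max k l + 1) • 1 + C : K →L[ℂ] K).toLinearMap) ?_
  rintro _ ⟨x, rfl⟩
  rw [← h]
  exact congrArg (fun T : K →L[ℂ] K => T x) hP.nil

end Compact

/-! ### Algebra of Fitting idempotents -/

section Algebra

variable {R : Type*} [Ring R] {N P S : R} {n : ℕ}

/-- This is what identifies $Q_{\bar z}(\bar\Gamma)$ with $P_z(\Gamma)^*$. -/
theorem IsFitting.star [StarRing R] (h : IsFitting N P S n) :
    IsFitting (star N) (star P) (star S) n where
  idem := by rw [← star_mul, h.idem]
  comm := by rw [← star_mul, ← star_mul, h.comm]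
  nil := by
    rw [← star_pow, ← star_mul, ((Commute.pow_left h.comm n : Commute (N ^ n) P)).symm.eq, h.nil,
      star_zero]
  mul_inv := by rw [← star_mul, h.inv_mul, star_sub, star_one]
  inv_mul := by rw [← star_mul, h.mul_inv, star_sub, star_one]
  inv_proj := by rw [← star_mul, h.proj_inv, star_zero]
  proj_inv := by rw [← star_mul, h.inv_proj, star_zero]

variable [Algebra ℂ R]

/-- The idempotent of a Fitting decomposition does not change if `N` is multiplied by a commuting
unit and a non-zero scalar. -/
theorem IsFitting.smul_mul_unit_inv (h : IsFitting N P S n) {c : ℂ} (hc : c ≠ 0) (E : Rˣ)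
    (hEN : Commute (E : R) N) (hEP : Commute (E : R) P) :
    IsFitting (c • (N * ↑E⁻¹)) P (c⁻¹ • (S * E)) n := by
  have hEN' : Commute (↑E⁻¹ : R) N := hEN.units_inv_left
  have hEP' : Commute (↑E⁻¹ : R) P := hEP.units_inv_left
  refine ⟨h.idem, ?_, ?_, ?_, ?_, ?_, ?_⟩
  · rw [smul_mul_assoc, mul_smul_comm, mul_assoc, hEP'.eq, ← mul_assoc, h.comm, mul_assoc]
  · rw [smul_pow, hEN'.symm.mul_pow, smul_mul_assoc, mul_assoc, (hEP'.pow_left n).eq, ← mul_assoc,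
      h.nil, zero_mul, smul_zero]
  · have hNS : N * S = S * N := h.mul_inv.trans h.inv_mul.symm
    have : N * ↑E⁻¹ * (S * E) = 1 - P := by
      have h1 : N * ↑E⁻¹ * (S * ↑E) = ↑E⁻¹ * (N * S) * E := by rw [← hEN'.eq]; noncomm_ring
      have h2 : ↑E⁻¹ * (N * S) = (N * S) * ↑E⁻¹ := by
        rw [h.mul_inv, mul_sub, sub_mul, hEP'.eq, mul_one, one_mul]
      rw [h1, h2, mul_assoc, Units.inv_mul, mul_one, h.mul_inv]
    rw [smul_mul_smul_comm, mul_inv_cancel₀ hc, one_smul, this]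
  · have : S * E * (N * ↑E⁻¹) = 1 - P := by
      rw [← hEN'.eq, mul_assoc, ← mul_assoc (E : R), Units.mul_inv, one_mul, h.inv_mul]
    rw [smul_mul_smul_comm, inv_mul_cancel₀ hc, one_smul, this]
  · rw [smul_mul_assoc, mul_assoc, hEP.eq, ← mul_assoc, h.inv_proj, zero_mul, smul_zero]
  · rw [mul_smul_comm, ← mul_assoc, h.proj_inv, zero_mul, smul_zero]

open Polynomial in
/-- The idempotents belonging to different spectral values annihilate each other. -/
theorem IsFitting.mul_eq_zero {A P' S' : R} {σ σ' : ℂ} {m : ℕ} (hσ : σ ≠ σ')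
    (h : IsFitting (A - σ • 1) P S n) (h' : IsFitting (A - σ' • 1) P' S' m) : P * P' = 0 := by
  obtain ⟨a, b, hab⟩ : IsCoprime ((X - C σ) ^ n) ((X - C σ') ^ m) :=
    (isCoprime_X_sub_C_of_isUnit_sub (sub_ne_zero.2 hσ).isUnit).pow
  replace hab := congrArg (aeval A) hab
  simp only [map_add, map_mul, map_pow, map_sub, aeval_X, aeval_C, map_one,
    Algebra.algebraMap_eq_smul_one] at hab
  have hcomm : Commute (A - σ' • 1) P := by
    have h1 : Commute (A - σ • 1) P := h.comm
    have h2 : A - σ' • 1 = (A - σ • 1) + (σ - σ') • 1 := by rw [sub_smul]; abel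
    rw [h2]
    exact h1.add_left ((Commute.one_left P).smul_left _)
  calc P * P' = (aeval A a * (A - σ • 1) ^ n + aeval A b * (A - σ' • 1) ^ m) * (P * P') := by
        rw [hab, one_mul]
    _ = aeval A a * ((A - σ • 1) ^ n * P) * P'
        + aeval A b * ((A - σ' • 1) ^ m * P) * P' := by noncomm_ring
    _ = aeval A b * (P * ((A - σ' • 1) ^ m * P')) := by
        rw [h.nil, (hcomm.pow_left m).eq]; noncomm_ring
    _ = 0 := by rw [h'.nil, mul_zero, mul_zero]

end Algebra

/-! ### The contour integral of the resolvent -/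

section Riesz

variable {R : Type*} [NormedRing R] [NormedAlgebra ℂ R] [CompleteSpace R]
  {A P S : R} {σ : ℂ} {n : ℕ}

/-- The Laurent expansion of the resolvent near an isolated point of the spectrum. -/
theorem IsFitting.resolvent_eq (h : IsFitting (A - σ • 1) P S n) {ζ : ℂ} (hζ : ζ ≠ σ)
    (hS : ‖(ζ - σ) • S‖ < 1) :
    resolvent A ζ = (∑ k ∈ Finset.range n, (ζ - σ) ^ (-(k + 1 : ℤ)) • ((A - σ • 1) ^ k * P))
      - S * Ring.inverse (1 - (ζ - σ) • S) := by
  set N : R := A - σ • 1 with hN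
  set w : ℂ := ζ - σ with hw
  have hw0 : w ≠ 0 := sub_ne_zero.2 hζ
  obtain ⟨V, hV⟩ := isUnit_one_sub_of_norm_lt_one hS
  rw [← hV, Ring.inverse_unit]
  have hNP : Commute N P := h.comm
  have hNS : Commute N S := h.mul_inv.trans h.inv_mul.symm
  -- On the range of $P$ the inverse of $w-N$ is a finite geometric series, whose product with $w-N$
  -- telescopes. On the complement $N$ has inverse $S$, so the inverse of $w-N$ is $-S(1-wS)^{-1}$,
  -- holomorphic at $w=0$.
  set X : R := ∑ k ∈ Finset.range n, w ^ (-(k + 1 : ℤ)) • (N ^ k * P) with hX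
  have hNX : Commute N X := Commute.sum_right _ _ _ fun k _ =>
    (((Commute.refl N).pow_right k).mul_right hNP).smul_right _
  have hNV : Commute N (V : R) := by
    rw [hV]; exact (Commute.one_right N).sub_right (hNS.smul_right w)
  have hcomm : Commute (w • 1 - N) (X - S * ↑V⁻¹) := by
    refine Commute.sub_left ((Commute.one_left _).smul_left w) ?_
    exact hNX.sub_right (hNS.mul_right hNV.units_inv_right)
  have h1 : (w • 1 - N) * X = P := by
    have : ∀ k ∈ Finset.range n, (w • 1 - N) * (w ^ (-(k + 1 : ℤ)) • (N ^ k * P)) =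
        w ^ (-(k : ℤ)) • (N ^ k * P) - w ^ (-((k + 1 : ℕ) : ℤ)) • (N ^ (k + 1) * P) := by
      intro k _
      have hz : w * w ^ (-(k + 1 : ℤ)) = w ^ (-(k : ℤ)) := by
        rw [← zpow_one_add₀ hw0]; congr 1; ring
      rw [sub_mul, smul_one_mul, smul_smul, hz, mul_smul_comm, ← mul_assoc, ← pow_succ']
      push_cast; rfl
    rw [hX, Finset.mul_sum, Finset.sum_congr rfl this,
      Finset.sum_range_sub' (fun k : ℕ => w ^ (-(k : ℤ)) • (N ^ k * P)), h.nil]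
    simp
  have hPV : P * ↑V⁻¹ = P := by
    have : P * V = P := by rw [hV, mul_sub, mul_smul_comm, h.proj_inv]; simp
    calc P * ↑V⁻¹ = P * V * ↑V⁻¹ := by rw [this]
      _ = P := by rw [mul_assoc, Units.mul_inv, mul_one]
  have h2 : (w • 1 - N) * (S * ↑V⁻¹) = P - 1 := by
    rw [← mul_assoc, sub_mul, h.mul_inv, smul_one_mul]
    have : w • S - (1 - P) = P - V := by rw [hV]; abel
    rw [this, sub_mul, hPV, Units.mul_inv]
  have h3 : (w • 1 - N) * (X - S * ↑V⁻¹) = 1 := by rw [mul_sub, h1, h2]; abel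
  have h4 : algebraMap ℂ R ζ - A = w • 1 - N := by
    rw [hN, hw, Algebra.algebraMap_eq_smul_one, sub_smul]; abel
  rw [resolvent, h4]
  exact Ring.inverse_unit ⟨_, _, h3, by rw [← hcomm.eq, h3]⟩

/-- The contour integral of the resolvent over a small circle. -/
theorem IsFitting.circleIntegral_resolvent (h : IsFitting (A - σ • 1) P S n) {ε : ℝ} (hε : 0 < ε)
    (hS : ε * ‖S‖ < 1) : ∮ ζ in C(σ, ε), resolvent A ζ = (2 * (Real.pi : ℂ) * Complex.I) • P := by
  have hn : ∀ ζ ∈ Metric.closedBall σ ε, ‖(ζ - σ) • S‖ < 1 := fun ζ hζ => by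
    rw [norm_smul]
    refine (mul_le_mul_of_nonneg_right ?_ (norm_nonneg _)).trans_lt hS
    simpa [dist_eq_norm] using hζ
  have hne : ∀ ζ ∈ Metric.sphere σ ε, ζ ≠ σ := fun ζ hζ => Metric.ne_of_mem_sphere hζ hε.ne'
  have hd : ∀ ζ ∈ Metric.closedBall σ ε,
      DifferentiableAt ℂ (fun ζ : ℂ => S * Ring.inverse (1 - (ζ - σ) • S)) ζ := fun ζ hζ => by
    refine DifferentiableAt.const_mul ?_ S
    refine DifferentiableAt.inverse ?_ (isUnit_one_sub_of_norm_lt_one (hn ζ hζ))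
    fun_prop
  have hcont : ContinuousOn (fun ζ : ℂ => S * Ring.inverse (1 - (ζ - σ) • S))
      (Metric.closedBall σ ε) := fun ζ hζ => (hd ζ hζ).continuousAt.continuousWithinAt
  have hi : ∀ k : ℕ, CircleIntegrable
      (fun ζ : ℂ => (ζ - σ) ^ (-(k + 1 : ℤ)) • ((A - σ • 1) ^ k * P)) σ ε := fun k => by
    refine ContinuousOn.circleIntegrable hε.le fun ζ hζ => ?_
    refine ContinuousAt.continuousWithinAt (ContinuousAt.smul ?_ continuousAt_const)
    exact (continuousAt_id.sub continuousAt_const).zpow₀ _ (Or.inl (sub_ne_zero.2 (hne ζ hζ)))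
  rw [circleIntegral.integral_congr hε.le fun ζ hζ =>
    h.resolvent_eq (hne ζ hζ) (hn ζ (Metric.sphere_subset_closedBall hζ))]
  rw [circleIntegral.integral_sub (CircleIntegrable.fun_sum _ fun k _ => hi k)
    ((hcont.mono Metric.sphere_subset_closedBall).circleIntegrable hε.le),
    circleIntegral.integral_fun_sum fun k _ => hi k,
    Complex.circleIntegral_eq_zero_of_differentiable_on_off_countable hε.le Set.countable_empty
      hcont fun ζ hζ => hd ζ (Metric.ball_subset_closedBall hζ.1), sub_zero]
  simp only [circleIntegral.integral_smul_const]
  -- Only the term $k=0$ has a residue. For order 0 there is no such term, but then $P=0$.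
  cases n with
  | zero =>
    have : P = 0 := by simpa using h.nil
    simp [this]
  | succ n =>
    rw [Finset.sum_range_succ', Finset.sum_eq_zero fun k _ => ?_]
    · simp only [CharP.cast_eq_zero, zero_add, zpow_neg_one, pow_zero, one_mul]
      rw [circleIntegral.integral_sub_center_inv _ hε.ne']
    · rw [circleIntegral.integral_sub_zpow_of_ne (by lia), zero_smul]

end Riesz

/-- The integral equals $2\pi i P$ exactly for every radius below $(\|S\|+1)^{-1}$, so the limit
defining the idempotent is that of an eventually constant function. -/
theorem IsFitting.rieszIdempotent_eq {K : Type*} [NormedAddCommGroup K] [InnerProductSpace ℂ K]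
    [CompleteSpace K] {A P S : K →L[ℂ] K} {σ : ℂ} {n : ℕ} (h : IsFitting (A - σ • 1) P S n) :
    rieszIdempotent A σ = P := by
  refine Filter.Tendsto.limUnder_eq (tendsto_const_nhds.congr' ?_)
  have hpos : 0 < (‖S‖ + 1)⁻¹ := by positivity
  filter_upwards [Ioo_mem_nhdsGT hpos] with ε hε
  have hS : ε * ‖S‖ < 1 := by
    have h1 : ε * (‖S‖ + 1) < 1 := by
      have := mul_lt_mul_of_pos_right hε.2 (show 0 < ‖S‖ + 1 by positivity)
      rwa [inv_mul_cancel₀ (by positivity)] at this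
    nlinarith [hε.1]
  rw [h.circleIntegral_resolvent hε.1 hS, inv_smul_smul₀]
  exact Complex.two_pi_I_ne_zero

/-- `A` is injective on the range of the idempotent belonging to a non-zero spectral value. -/
theorem IsFitting.eq_zero_of_apply_eq_zero {K : Type*} [NormedAddCommGroup K]
    [InnerProductSpace ℂ K] {A P S : K →L[ℂ] K} {σ : ℂ} {n : ℕ} (hσ : σ ≠ 0)
    (h : IsFitting (A - σ • 1) P S n) {y : K} (hy : A (P y) = 0) : P y = 0 := by
  have h1 : ∀ k : ℕ, ((A - σ • 1) ^ k) (P y) = (-σ) ^ k • P y := fun k => by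
    induction k with
    | zero => simp
    | succ k ih =>
      have h2 : (A - σ • 1) (P y) = -σ • P y := by simp [hy]
      rw [pow_succ, mul_apply_eq_comp, h2, map_smul, ih, smul_smul, pow_succ']
  have h2 : ((A - σ • 1) ^ n) (P y) = 0 := congrArg (fun T : K →L[ℂ] K => T y) h.nil
  rw [h1] at h2
  exact (smul_eq_zero.1 h2).resolve_left (pow_ne_zero _ (neg_ne_zero.2 hσ))

/-! ### Dissipative operators and Hermitian forms -/

section Inertia

/-- A Hermitian form `⟪u, J v⟫` on a finite-dimensional space with a strictly dissipative operator
`N` all of whose eigenvalues lie in the upper half-plane is positive definite. -/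
theorem re_inner_pos_of_dissipative {K : Type*} [NormedAddCommGroup K] [InnerProductSpace ℂ K]
    {J N : K →ₗ[ℂ] K} (hJ : J.IsSymmetric) (W : Submodule ℂ K) [FiniteDimensional ℂ W]
    (hNW : ∀ u ∈ W, N u ∈ W)
    (hdiss : ∀ u ∈ W, u ≠ 0 → 0 < (inner ℂ u (J (N u))).im)
    (hev : ∀ (μ : ℂ), ∀ v ∈ W, v ≠ 0 → N v = μ • v → 0 < μ.im) :
    ∀ u ∈ W, u ≠ 0 → 0 < (inner ℂ u (J u)).re := by
  obtain ⟨n, hn⟩ : ∃ n, Module.finrank ℂ W = n := ⟨_, rfl⟩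
  induction n generalizing W with
  | zero =>
    intro u hu hu0
    have : W = ⊥ := Submodule.finrank_eq_zero.1 hn
    exact absurd ((Submodule.mem_bot ℂ).1 (this ▸ hu)) hu0
  | succ n ih =>
    have : Nontrivial W := Module.nontrivial_of_finrank_pos (R := ℂ) (by lia)
    let g : Module.End ℂ W := N.restrict hNW
    obtain ⟨μ, hμ⟩ := Module.End.exists_eigenvalue g
    obtain ⟨v, hv⟩ := hμ.exists_hasEigenvector
    have hμ0 : 0 < μ.im := by
      refine hev μ v v.2 (fun h => hv.2 (Subtype.ext h)) ?_
      exact congrArg Subtype.val hv.apply_eq_smul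
    have hlt : LinearMap.range (g - μ • 1) < ⊤ := by
      refine lt_top_iff_ne_top.2 fun h => ?_
      have h1 := LinearMap.ker_eq_bot_iff_range_eq_top.2 h
      refine hv.2 ((Submodule.mem_bot ℂ).1 (h1 ▸ ?_))
      simp [hv.apply_eq_smul]
    -- Any hyperplane containing the range of $g-\mu$ is $g$-invariant, so the induction hypothesis
    -- applies to it.
    obtain ⟨ℓ, hℓ, hle⟩ := Submodule.exists_le_ker_of_lt_top _ hlt
    let W' : Submodule ℂ K := (LinearMap.ker ℓ).map W.subtype
    have hW'W : W' ≤ W := Submodule.map_subtype_le _ _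
    have hmem : ∀ u : W, ℓ u = 0 → (u : K) ∈ W' := fun u hu => ⟨u, hu, rfl⟩
    have hfin : Module.finrank ℂ W' = n := by
      have h1 : Module.finrank ℂ W' = Module.finrank ℂ (LinearMap.ker ℓ) :=
        Submodule.finrank_map_subtype_eq _ _
      have h2 := LinearMap.finrank_range_add_finrank_ker ℓ
      rw [LinearMap.range_eq_top.2 (LinearMap.surjective hℓ), finrank_top,
        Module.finrank_self, hn] at h2
      lia
    have hNμ : ∀ u : W, N u - μ • (u : K) ∈ W' := fun u =>
      hmem ((g - μ • 1) u) (hle ⟨u, rfl⟩)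
    have : FiniteDimensional ℂ W' := Submodule.finiteDimensional_of_le hW'W
    have hpos := ih W' (fun u hu => by
        have := W'.add_mem (hNμ ⟨u, hW'W hu⟩) (W'.smul_mem μ hu)
        simpa using this)
      (fun u hu => hdiss u (hW'W hu)) (fun μ v hv => hev μ v (hW'W hv)) hfin
    let Φ : W →ₗ[ℂ] W' := (W'.orthogonalProjectionOnto : K →ₗ[ℂ] W') ∘ₗ J ∘ₗ W.subtype
    -- A dimension count gives a non-zero $w\in W$ with $Jw\perp W'$.
    obtain ⟨w, hw, hw0⟩ := (Submodule.ne_bot_iff _).1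
      (LinearMap.ker_ne_bot_of_finrank_lt (f := Φ) (by rw [hn, hfin]; lia))
    have horth : ∀ x ∈ W', inner ℂ x (J w) = 0 := by
      have h1 : W'.orthogonalProjectionOnto (J w) = 0 := hw
      rw [Submodule.orthogonalProjectionOnto_eq_zero_iff] at h1
      exact fun x hx => Submodule.inner_right_of_mem_orthogonal hx h1
    have horth' : ∀ x ∈ W', inner ℂ (w : K) (J x) = 0 := fun x hx => by
      rw [← hJ, ← inner_conj_symm, horth x hx, map_zero]
    have hwK : (w : K) ≠ 0 := fun h => hw0 (Subtype.ext h)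
    have hwpos : 0 < (inner ℂ (w : K) (J w)).re := by
      -- Since $Nw-\mu w\in W'$, orthogonality gives $\operatorname{Im}\langle
      -- w,JNw\rangle=\operatorname{Im}\mu\,\langle w,Jw\rangle$, and both the left side and
      -- $\operatorname{Im}\mu$ are positive.
      have h1 := hdiss w w.2 hwK
      have h2 : N w = (N w - μ • (w : K)) + μ • (w : K) := by abel
      have h3 : (inner ℂ (w : K) (J w)).im = 0 := hJ.im_inner_self_apply w
      rw [h2, map_add, map_smul, inner_add_right, horth' _ (hNμ w), zero_add, inner_smul_right,
        Complex.mul_im, h3, mul_zero, zero_add] at h1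
      exact (pos_iff_pos_of_mul_pos h1).1 hμ0
    -- Hence $w\notin W'$, and $W=\mathbb Cw\oplus W'$ is a $J$-orthogonal sum of two positive
    -- subspaces.
    have hℓw : ℓ w ≠ 0 := fun h => by
      have := horth _ (hmem w h)
      rw [this] at hwpos
      simp at hwpos
    intro u hu hu0
    set a : ℂ := ℓ ⟨u, hu⟩ / ℓ w with ha
    have hx : u - a • (w : K) ∈ W' := by
      refine hmem (⟨u, hu⟩ - a • w) ?_
      rw [map_sub, map_smul, smul_eq_mul, ha, div_mul_cancel₀ _ hℓw, sub_self]
    obtain ⟨x, hxdef⟩ : ∃ x, x = u - a • (w : K) := ⟨_, rfl⟩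
    rw [← hxdef] at hx
    have hu' : u = a • (w : K) + x := by rw [hxdef]; abel
    have hexp : (inner ℂ u (J u)).re =
        Complex.normSq a * (inner ℂ (w : K) (J w)).re + (inner ℂ x (J x)).re := by
      rw [hu', map_add, map_smul, inner_add_left, inner_add_right, inner_add_right,
        inner_smul_left, inner_smul_right, inner_smul_left, inner_smul_right, horth x hx,
        horth' x hx, ← mul_assoc, mul_comm (conj a) a, Complex.mul_conj]
      simp
    rw [hexp]
    by_cases hx0 : x = 0
    · have ha0 : a ≠ 0 := fun h => hu0 (by rw [hu', h, hx0]; simp)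
      rw [hx0]
      simpa using mul_pos (Complex.normSq_pos.2 ha0) hwpos
    · exact add_pos_of_nonneg_of_pos (mul_nonneg (Complex.normSq_nonneg a) hwpos.le) (hpos x hx hx0)

/-- The dimension of a sum of independent subspaces selected by a predicate. -/
theorem finsum_finrank_eq {V ι : Type*} [AddCommGroup V] [Module ℂ V] [FiniteDimensional ℂ V]
    {U : ι → Submodule ℂ V} (hU : iSupIndep U) (p : ι → Prop) :
    ∑ᶠ (i : ι) (_ : p i), (Module.finrank ℂ (U i) : ℤ) =
      Module.finrank ℂ (⨆ (i : ι) (_ : p i), U i : Submodule ℂ V) := by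
  classical
  have hfin : {i | U i ≠ ⊥}.Finite := WellFoundedGT.finite_ne_bot_of_iSupIndep hU
  have hsum : ∀ s : Finset ι, (∑ i ∈ s, (Module.finrank ℂ (U i) : ℤ)) =
      Module.finrank ℂ (⨆ i ∈ s, U i : Submodule ℂ V) := fun s => by
    induction s using Finset.induction_on with
    | empty =>
      have : (⨆ i ∈ (∅ : Finset ι), U i) = ⊥ := by simp
      rw [this, finrank_bot, Finset.sum_empty]; rfl
    | insert i s hi ih =>
      rw [Finset.sum_insert hi, ih, Finset.iSup_insert]
      have hdis : Disjoint (U i) (⨆ j ∈ s, U j) := hU.disjoint_biSup (y := (s : Set ι)) hi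
      have := Submodule.finrank_sup_add_finrank_inf_eq (U i) (⨆ j ∈ s, U j)
      rw [hdis.eq_bot, finrank_bot] at this
      exact_mod_cast this.symm
  let s : Finset ι := hfin.toFinset.filter p
  have h1 : (⨆ (i : ι) (_ : p i), U i) = ⨆ i ∈ s, U i := by
    refine le_antisymm (iSup₂_le fun i hi => ?_) (iSup₂_le fun i hi => ?_)
    · by_cases h : U i = ⊥
      · rw [h]; exact bot_le
      · exact le_iSup₂_of_le i (by simp [s, h, hi]) le_rfl
    · exact le_iSup₂_of_le i (Finset.mem_filter.1 hi).2 le_rfl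
  rw [h1, ← hsum s]
  rw [finsum_congr fun i => finsum_eq_if, finsum_eq_sum_of_support_subset (s := s)]
  · refine Finset.sum_congr rfl fun i hi => ?_
    rw [if_pos (Finset.mem_filter.1 hi).2]
  · intro i hi
    have h2 : p i ∧ U i ≠ ⊥ := by
      rw [Function.mem_support] at hi
      by_cases hp : p i
      · refine ⟨hp, fun h => hi ?_⟩
        rw [if_pos hp, h, finrank_bot]; rfl
      · exact absurd (if_neg hp) hi
    simp [s, h2.1, h2.2]

end Inertia

/-! ### Signature and $R$-index -/

section Signature

variable {K : Type*} [NormedAddCommGroup K] [InnerProductSpace ℂ K] [CompleteSpace K]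

open ContinuousLinearMap

/-- The rank of the positive part of `P* J P` is the dimension of a maximal positive subspace of the
range of `P`. -/
theorem rank_posPart_eq {J P : K →L[ℂ] K} (hJ : IsSelfAdjoint J) (hP : IsFiniteRank P)
    (hPP : P * P = P) {W₁ W₂ : Submodule ℂ K}
    (hW : W₁ ⊔ W₂ = LinearMap.range (P : K →ₗ[ℂ] K)) (hdisj : Disjoint W₁ W₂)
    (h₁ : ∀ u ∈ W₁, u ≠ 0 → 0 < (inner ℂ u (J u)).re)
    (h₂ : ∀ u ∈ W₂, u ≠ 0 → (inner ℂ u (J u)).re < 0) :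
    rank (adjoint P * J * P)⁺ = Module.finrank ℂ W₁ := by
  have : FiniteDimensional ℂ (LinearMap.range (P : K →ₗ[ℂ] K)) := hP
  have hW₁ : W₁ ≤ LinearMap.range (P : K →ₗ[ℂ] K) := hW ▸ le_sup_left
  have hW₂ : W₂ ≤ LinearMap.range (P : K →ₗ[ℂ] K) := hW ▸ le_sup_right
  have : FiniteDimensional ℂ W₁ := Submodule.finiteDimensional_of_le hW₁
  have : FiniteDimensional ℂ W₂ := Submodule.finiteDimensional_of_le hW₂
  have hPfix : ∀ u ∈ LinearMap.range (P : K →ₗ[ℂ] K), P u = u := by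
    rintro _ ⟨u, rfl⟩
    exact congrArg (fun T : K →L[ℂ] K => T u) hPP
  set M : K →L[ℂ] K := adjoint P * J * P with hM
  have hMsa : IsSelfAdjoint M := hJ.conjugate' P
  have hMq : ∀ u, inner ℂ u (M u) = inner ℂ (P u) (J (P u)) := fun u => by
    change inner ℂ u (adjoint P (J (P u))) = _
    rw [adjoint_inner_right]
  have hp : 0 ≤ M⁺ := CFC.posPart_nonneg M
  have hm : 0 ≤ M⁻ := CFC.negPart_nonneg M
  have hpq : ∀ u, 0 ≤ (inner ℂ u (M⁺ u)).re := fun u =>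
    ((nonneg_iff_isPositive _).1 hp).re_inner_nonneg_right u
  have hmq : ∀ u, 0 ≤ (inner ℂ u (M⁻ u)).re := fun u =>
    ((nonneg_iff_isPositive _).1 hm).re_inner_nonneg_right u
  have hsub : M⁺ - M⁻ = M := CFC.posPart_sub_negPart M
  have hMp : ∀ v ∈ LinearMap.range (M⁺ : K →L[ℂ] K).toLinearMap, M v = M⁺ v := by
    rintro _ ⟨u, rfl⟩
    have h : M * M⁺ = M⁺ * M⁺ := by
      conv_lhs => enter [1]; rw [← hsub]
      rw [sub_mul, CFC.negPart_mul_posPart, sub_zero]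
    exact congrArg (fun T : K →L[ℂ] K => T u) h
  -- On the range of $M^+$ the operators $M$ and $M^+$ agree; as $M=P^*JP$, $Pv=0$ forces $M^+v=0$,
  -- and the range and kernel of $M^+$ meet only in 0.
  have hPinj : ∀ v ∈ LinearMap.range (M⁺ : K →L[ℂ] K).toLinearMap, P v = 0 → v = 0 := by
    intro v hv hPv
    have h1 : M⁺ v = 0 := by
      rw [← hMp v hv]
      change adjoint P (J (P v)) = 0
      rw [hPv, map_zero, map_zero]
    obtain ⟨u, rfl⟩ := hv
    have h2 : inner ℂ (M⁺ u) (M⁺ u) = 0 := by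
      have h3 : adjoint (M⁺ : K →L[ℂ] K) = M⁺ := (IsSelfAdjoint.of_nonneg hp)
      conv_lhs => enter [2]; rw [← h3]
      rw [adjoint_inner_left]
      exact (congrArg (inner ℂ u) h1).trans (inner_zero_right _)
    exact inner_self_eq_zero.1 h2
  set Y := LinearMap.range (M⁺ : K →L[ℂ] K).toLinearMap with hY
  let f : Y →ₗ[ℂ] LinearMap.range (P : K →ₗ[ℂ] K) :=
    (P : K →ₗ[ℂ] K).rangeRestrict ∘ₗ Y.subtype
  have hf : Function.Injective f := by
    refine (injective_iff_map_eq_zero f).2 fun v hv => Subtype.ext ?_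
    exact hPinj v v.2 (congrArg Subtype.val hv)
  have : FiniteDimensional ℂ Y := FiniteDimensional.of_injective f hf
  refine le_antisymm ?_ ?_
  -- Upper bound: the form is non-negative on $Z=P(\operatorname{ran}M^+)$, so $Z$ meets the
  -- negative subspace $W_2$ trivially inside $\operatorname{ran}P=W_1\oplus W_2$.
  · let Z : Submodule ℂ K := Y.map (P : K →ₗ[ℂ] K)
    have : FiniteDimensional ℂ Z := inferInstance
    have hZ : Module.finrank ℂ Y ≤ Module.finrank ℂ Z := by
      refine LinearMap.finrank_le_finrank_of_injective
        (f := ((P : K →ₗ[ℂ] K) ∘ₗ Y.subtype).codRestrict Z fun v => ⟨v, v.2, rfl⟩) ?_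
      refine (injective_iff_map_eq_zero _).2 fun v hv => Subtype.ext ?_
      exact hPinj v v.2 (congrArg Subtype.val hv)
    have hZW : Disjoint Z W₂ := by
      refine Submodule.disjoint_def.2 ?_
      rintro _ ⟨v, hv, rfl⟩ hv2
      by_contra h0
      have h3 := h₂ _ hv2 h0
      have h4 := hMq v
      rw [hMp v hv] at h4
      have h5 := hpq v
      rw [h4] at h5
      exact absurd h3 (not_lt.2 h5)
    have hle : Z ⊔ W₂ ≤ LinearMap.range (P : K →ₗ[ℂ] K) :=
      sup_le (by rintro _ ⟨v, -, rfl⟩; exact ⟨v, rfl⟩) hW₂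
    have e1 := Submodule.finrank_sup_add_finrank_inf_eq Z W₂
    have e2 := Submodule.finrank_sup_add_finrank_inf_eq W₁ W₂
    have e3 := Submodule.finrank_mono hle
    rw [hZW.eq_bot, finrank_bot] at e1
    rw [hdisj.eq_bot, finrank_bot, hW] at e2
    change Module.finrank ℂ Y ≤ _
    lia
  -- Lower bound: $M^+$ is injective on $W_1$, since $M^+u=0$ would give $\langle
  -- u,Ju\rangle=-\langle u,M^-u\rangle\le0$.
  · let g : W₁ →ₗ[ℂ] Y := (M⁺ : K →L[ℂ] K).toLinearMap.rangeRestrict ∘ₗ W₁.subtype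
    refine LinearMap.finrank_le_finrank_of_injective (f := g) ?_
    refine (injective_iff_map_eq_zero g).2 fun u hu => ?_
    by_contra h0
    have hu0 : (u : K) ≠ 0 := fun h => h0 (Subtype.ext h)
    have hu' : M⁺ (u : K) = 0 := congrArg Subtype.val hu
    have h3 := h₁ u u.2 hu0
    have h4 := hMq u
    rw [hPfix u (hW₁ u.2)] at h4
    rw [← h4, ← hsub, sub_apply, hu', zero_sub, inner_neg_right, Complex.neg_re] at h3
    linarith [hmq u]

/-- A finite-rank operator `N` which is strictly dissipative on a subspace containing its range,
with respect to a Hermitian form, is of class `R`. -/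
theorem isClassR_of_dissipative {J P N : K →L[ℂ] K} (hJ : IsSelfAdjoint J) (hP : IsFiniteRank P)
    (hN : P * N = N)
    (hdiss : ∀ u ∈ LinearMap.range (P : K →ₗ[ℂ] K), u ≠ 0 → 0 < (inner ℂ u (J (N u))).im) :
    IsClassR N := by
  have : FiniteDimensional ℂ (LinearMap.range (P : K →ₗ[ℂ] K)) := hP
  have hmem : ∀ u, N u ∈ LinearMap.range (P : K →ₗ[ℂ] K) := fun u =>
    ⟨N u, congrArg (fun T : K →L[ℂ] K => T u) hN⟩
  have hle : LinearMap.range (N : K →ₗ[ℂ] K) ≤ LinearMap.range (P : K →ₗ[ℂ] K) := by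
    rintro _ ⟨u, rfl⟩; exact hmem u
  have hfr : IsFiniteRank N := Submodule.finiteDimensional_of_le hle
  refine ⟨hfr, fun x hx => ?_, fun f hf => ?_⟩
  · by_contra h0
    have hcomp : IsCompactOperator N := by
      have : FiniteDimensional ℂ (LinearMap.range (N : K →ₗ[ℂ] K)) := hfr
      have : ProperSpace (LinearMap.range (N : K →ₗ[ℂ] K)) := FiniteDimensional.proper_rclike ℂ _
      exact (isCompactOperator_of_locallyCompactSpace_rng
        (LinearMap.range (N : K →ₗ[ℂ] K)).subtypeL).comp_clm N.rangeRestrict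
    obtain ⟨v, hv⟩ := ((hcomp.hasEigenvalue_iff_mem_spectrum (Complex.ofReal_ne_zero.2 h0)).2
      hx).exists_hasEigenvector
    have hv1 : N v = (x : ℂ) • v := hv.apply_eq_smul
    have hvP : v ∈ LinearMap.range (P : K →ₗ[ℂ] K) := by
      have : v = (x : ℂ)⁻¹ • N v := by rw [hv1, inv_smul_smul₀ (Complex.ofReal_ne_zero.2 h0)]
      rw [this]
      exact Submodule.smul_mem _ _ (hmem v)
    have h1 := hdiss v hvP hv.2
    have h2 : (inner ℂ v (J v)).im = 0 := hJ.isSymmetric.im_inner_self_apply v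
    rw [hv1, map_smul, inner_smul_right, Complex.im_ofReal_mul, h2, mul_zero] at h1
    exact lt_irrefl _ h1
  · by_contra h0
    have h1 := hdiss (N f) (hmem f) h0
    rw [hf, map_zero, inner_zero_right] at h1
    exact lt_irrefl _ h1

/-- The sum of the generalized eigenspaces for the eigenvalues satisfying `p`. -/
def genEigenspaceSup {V : Type*} [AddCommGroup V] [Module ℂ V] (g : Module.End ℂ V)
    (p : ℂ → Prop) : Submodule ℂ V :=
  ⨆ (μ : ℂ) (_ : p μ), g.maxGenEigenspace μ

section GenEigenspaceSup

variable {V : Type*} [AddCommGroup V] [Module ℂ V] (g : Module.End ℂ V)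

theorem apply_mem_genEigenspaceSup {p : ℂ → Prop} {v : V} (hv : v ∈ genEigenspaceSup g p) :
    g v ∈ genEigenspaceSup g p := by
  have : genEigenspaceSup g p ≤ (genEigenspaceSup g p).comap g :=
    iSup₂_le fun ν hν x hx => (le_iSup₂_of_le (f := fun ν (_ : p ν) => g.maxGenEigenspace ν) ν hν
      le_rfl) (Module.End.mapsTo_maxGenEigenspace_of_comm (Commute.refl g) ν hx)
  exact this hv

theorem of_mem_genEigenspaceSup {p : ℂ → Prop} {v : V} (hv : v ∈ genEigenspaceSup g p)
    (hv0 : v ≠ 0) {μ : ℂ} (hμ : g v = μ • v) : p μ := by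
  by_contra hp
  have hd : Disjoint (g.maxGenEigenspace μ) (genEigenspaceSup g p) :=
    g.independent_maxGenEigenspace.disjoint_biSup (y := {ν | p ν}) hp
  refine hv0 (Submodule.disjoint_def.1 hd v ?_ hv)
  exact Module.End.genEigenspace_le_maximal g μ 1 (Module.End.mem_eigenspace_iff.2 hμ)

theorem maxGenEigenspace_le_genEigenspaceSup {p : ℂ → Prop} {μ : ℂ} (hμ : p μ) :
    g.maxGenEigenspace μ ≤ genEigenspaceSup g p :=
  le_iSup₂_of_le (f := fun ν (_ : p ν) => g.maxGenEigenspace ν) μ hμ le_rfl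

theorem disjoint_genEigenspaceSup {p q : ℂ → Prop} (hpq : ∀ μ, p μ → ¬ q μ) :
    Disjoint (genEigenspaceSup g p) (genEigenspaceSup g q) := by
  have hd : Disjoint {μ | p μ} {μ | q μ} := Set.disjoint_left.2 fun μ h h' => hpq μ h h'
  have h := g.independent_maxGenEigenspace.disjoint_biSup_biSup hd
  simpa only [Set.mem_ofPred_eq, genEigenspaceSup] using h

theorem genEigenspaceSup_sup_eq_top [FiniteDimensional ℂ V]
    (hg : ∀ (μ : ℂ) (v : V), v ≠ 0 → g v = μ • v → μ.im ≠ 0) :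
    genEigenspaceSup g (fun μ => 0 < μ.im) ⊔ genEigenspaceSup g (fun μ => μ.im < 0) = ⊤ := by
  refine top_le_iff.1 ?_
  rw [← Module.End.iSup_maxGenEigenspace_eq_top g]
  refine iSup_le fun μ => ?_
  rcases lt_trichotomy μ.im 0 with h | h | h
  · exact (maxGenEigenspace_le_genEigenspaceSup g (p := fun μ => μ.im < 0) h).trans le_sup_right
  · by_contra hne
    have h1 : g.HasUnifEigenvalue μ ⊤ := fun hbot => hne (hbot.le.trans bot_le)
    obtain ⟨v, hv⟩ := Module.End.HasEigenvalue.exists_hasEigenvector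
      ((Module.End.hasUnifEigenvalue_iff_hasUnifEigenvalue_one (by simp)).1 h1)
    exact hg μ v hv.2 hv.apply_eq_smul h
  · exact (maxGenEigenspace_le_genEigenspaceSup g (p := fun μ => 0 < μ.im) h).trans le_sup_left

end GenEigenspaceSup

omit [CompleteSpace K] in
/-- The algebraic multiplicity of a non-zero eigenvalue may be computed on any subspace that
contains the range. -/
theorem algMult_eq_finrank_restrict {N : K →L[ℂ] K} {X : Submodule ℂ K} (hmem : ∀ u, N u ∈ X)
    {μ : ℂ} (hμ : μ ≠ 0) :
    algMult N μ = Module.finrank ℂ (Module.End.maxGenEigenspace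
      (LinearMap.restrict (N : Module.End ℂ K) fun u (_ : u ∈ X) => hmem u) μ) := by
  have hle : Module.End.maxGenEigenspace (N : Module.End ℂ K) μ ≤ X := by
    intro v hv
    obtain ⟨k, hk⟩ := (Module.End.mem_maxGenEigenspace _ _ _).1 hv
    clear hv
    induction k generalizing v with
    | zero =>
      have : v = 0 := hk
      rw [this]; exact X.zero_mem
    | succ k ih =>
      rw [pow_succ, Module.End.mul_apply] at hk
      have h1 := ih hk
      -- Solving $(N-\mu)v$ for $v$ requires $\mu\ne0$; one factor of $N-\mu$ is removed at each
      -- induction step.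
      have h2 : v = μ⁻¹ • (N v - ((N : Module.End ℂ K) - μ • 1) v) := by
        simp [smul_smul, hμ]
      rw [h2]
      exact X.smul_mem _ (X.sub_mem (hmem v) h1)
  have h := Submodule.inf_genEigenspace (N : Module.End ℂ K) X (k := ⊤) (μ := μ) fun u _ => hmem u
  rw [inf_eq_right.2 hle] at h
  rw [algMult, h]
  exact Submodule.finrank_map_subtype_eq _ _

omit [CompleteSpace K] in
-- The open half-planes omit 0, the only eigenvalue whose generalized eigenspace need not lie in
-- $X$.
theorem rIndex_eq_finrank_sub_finrank {N : K →L[ℂ] K} {X : Submodule ℂ K} [FiniteDimensional ℂ X]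
    (hmem : ∀ u, N u ∈ X) {g : Module.End ℂ X}
    (hg : g = LinearMap.restrict (N : Module.End ℂ K) fun u (_ : u ∈ X) => hmem u) :
    rIndex N = (Module.finrank ℂ (genEigenspaceSup g fun μ => 0 < μ.im) : ℤ) -
      Module.finrank ℂ (genEigenspaceSup g fun μ => μ.im < 0) := by
  have h1 : ∀ μ : ℂ, μ ≠ 0 → (algMult N μ : ℤ) = Module.finrank ℂ (g.maxGenEigenspace μ) :=
    fun μ hμ => by rw [hg, algMult_eq_finrank_restrict hmem hμ]
  have h2 : ∀ p : ℂ → Prop, (∀ μ, p μ → μ ≠ 0) → ∑ᶠ (μ : ℂ) (_ : p μ), (algMult N μ : ℤ) =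
      Module.finrank ℂ (genEigenspaceSup g p) := fun p hp => by
    rw [genEigenspaceSup, ← finsum_finrank_eq g.independent_maxGenEigenspace p]
    exact finsum_congr fun μ => finsum_congr fun hμ => h1 μ (hp μ hμ)
  rw [rIndex, h2 _ fun μ hμ h => by simp [h] at hμ, h2 _ fun μ hμ h => by simp [h] at hμ]

/-- The inertia theorem: the signature of the form `J` on the range of `P` is the `R`-index of a
strictly dissipative operator. -/
theorem signature_eq_rIndex {J P N : K →L[ℂ] K} (hJ : IsSelfAdjoint J) (hP : IsFiniteRank P)
    (hPP : P * P = P) (hN : P * N = N)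
    (hdiss : ∀ u ∈ LinearMap.range (P : K →ₗ[ℂ] K), u ≠ 0 → 0 < (inner ℂ u (J (N u))).im) :
    signature (adjoint P * J * P) = rIndex N := by
  have : FiniteDimensional ℂ (LinearMap.range (P : K →ₗ[ℂ] K)) := hP
  have hmem : ∀ u, N u ∈ LinearMap.range (P : K →ₗ[ℂ] K) := fun u =>
    ⟨N u, congrArg (fun T : K →L[ℂ] K => T u) hN⟩
  obtain ⟨X, hX⟩ : ∃ X, X = LinearMap.range (P : K →ₗ[ℂ] K) := ⟨_, rfl⟩
  rw [← hX] at hmem hdiss this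
  obtain ⟨g, hg⟩ : ∃ g : Module.End ℂ X, g =
    LinearMap.restrict (N : Module.End ℂ K) fun u (_ : u ∈ X) => hmem u := ⟨_, rfl⟩
  have hgN : ∀ v : X, (g v : K) = N v := fun v => by rw [hg]; rfl
  have hgreal : ∀ (μ : ℂ) (v : X), v ≠ 0 → g v = μ • v → μ.im ≠ 0 := fun μ v hv hgv him => by
    have h1 := hdiss v v.2 fun h => hv (Subtype.ext h)
    have h2 : (inner ℂ (v : K) (J v)).im = 0 := hJ.isSymmetric.im_inner_self_apply (v : K)
    rw [← hgN, hgv, Submodule.coe_smul, map_smul, inner_smul_right, Complex.mul_im, h2, him] at h1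
    simp at h1
  set V₁ := genEigenspaceSup g fun μ => 0 < μ.im with hV₁
  set V₂ := genEigenspaceSup g fun μ => μ.im < 0 with hV₂
  have hsup : V₁.map X.subtype ⊔ V₂.map X.subtype = X := by
    rw [← Submodule.map_sup, genEigenspaceSup_sup_eq_top g hgreal, Submodule.map_top,
      Submodule.range_subtype]
  have hdisj : Disjoint (V₁.map X.subtype) (V₂.map X.subtype) :=
    Submodule.disjoint_map X.injective_subtype (disjoint_genEigenspaceSup g fun _ => lt_asymm)
  have hpos : ∀ u ∈ V₁.map X.subtype, u ≠ 0 → 0 < (inner ℂ u (J u)).re := by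
    refine re_inner_pos_of_dissipative (J := (J : K →ₗ[ℂ] K)) (N := (N : K →ₗ[ℂ] K))
      hJ.isSymmetric _ ?_ ?_ ?_
    · rintro _ ⟨v, hv, rfl⟩
      exact ⟨g v, apply_mem_genEigenspaceSup g hv, hgN v⟩
    · rintro _ ⟨v, hv, rfl⟩ h0
      exact hdiss v v.2 h0
    · rintro μ _ ⟨v, hv, rfl⟩ h0 hμ
      exact of_mem_genEigenspaceSup g hv (fun h => h0 (by rw [h]; rfl))
        (Subtype.ext ((hgN v).trans hμ))
  -- Changing the signs of both $J$ and $N$ preserves dissipativity and reflects the eigenvalues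
  -- into the upper half-plane.
  have hneg : ∀ u ∈ V₂.map X.subtype, u ≠ 0 → 0 < (inner ℂ u ((-J) u)).re := by
    refine re_inner_pos_of_dissipative (J := ((-J : K →L[ℂ] K) : K →ₗ[ℂ] K))
      (N := ((-N : K →L[ℂ] K) : K →ₗ[ℂ] K)) hJ.neg.isSymmetric _ ?_ ?_ ?_
    · rintro _ ⟨v, hv, rfl⟩
      exact ⟨-g v, neg_mem (apply_mem_genEigenspaceSup g hv), congrArg Neg.neg (hgN v)⟩
    · rintro _ ⟨v, hv, rfl⟩ h0
      have := hdiss v v.2 h0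
      simpa using this
    · rintro μ _ ⟨v, hv, rfl⟩ h0 hμ
      have hμ' : -N (v : K) = μ • (v : K) := hμ
      have hgv : g v = (-μ) • v := Subtype.ext (by
        rw [hgN, Submodule.coe_smul, neg_smul, ← hμ', neg_neg])
      have := of_mem_genEigenspaceSup g hv (fun h => h0 (by rw [h]; rfl)) hgv
      simpa using this
  replace hsup := hsup.trans hX
  have r₁ : rank (adjoint P * J * P)⁺ = Module.finrank ℂ V₁ := by
    rw [rank_posPart_eq hJ hP hPP hsup hdisj hpos fun u hu h0 => by simpa using hneg u hu h0]
    exact Submodule.finrank_map_subtype_eq _ _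
  have r₂ : rank (adjoint P * J * P)⁻ = Module.finrank ℂ V₂ := by
    have h1 : (adjoint P * J * P)⁻ = (adjoint P * (-J) * P)⁺ := by
      rw [mul_neg, neg_mul, CFC.posPart_neg]
    rw [h1, rank_posPart_eq hJ.neg hP hPP ((sup_comm _ _).trans hsup) hdisj.symm hneg
      fun u hu h0 => by simpa using hpos u hu h0]
    exact Submodule.finrank_map_subtype_eq _ _
  rw [signature, r₁, r₂, rIndex_eq_finrank_sub_finrank hmem hg]

end Signature

/-! ### Closed and self-adjoint operators -/

section Unbounded

variable {H K : Type*} [NormedAddCommGroup H] [InnerProductSpace ℂ H] [CompleteSpace H]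
  [NormedAddCommGroup K] [InnerProductSpace ℂ K] [CompleteSpace K]

/-- The domain of the adjoint of a closed operator is dense. -/
theorem dense_adjoint_domain {F : H →ₗ.[ℂ] K} (hc : F.IsClosed) :
    Dense (F†.domain : Set K) := by
  rw [Submodule.dense_iff_topologicalClosure_eq_top,
    Submodule.topologicalClosure_eq_top_iff, Submodule.eq_bot_iff]
  intro y hy
  let e := WithLp.prodContinuousLinearEquiv 2 ℂ H K
  let G : Submodule ℂ (WithLp 2 (H × K)) := F.graph.comap (e : WithLp 2 (H × K) →ₗ[ℂ] H × K)
  have hG : IsClosed (G : Set (WithLp 2 (H × K))) := IsClosed.preimage e.continuous hc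
  have : CompleteSpace G := hG.completeSpace_coe
  -- The orthogonal complement of the graph consists of vectors $(-F^*v,v)$. If
  -- $y\perp\operatorname{dom}F^*$, then $(0,y)$ is orthogonal to all of them, so it lies in the
  -- closed graph and $y=F0=0$.
  have hmem : WithLp.toLp 2 ((0 : H), y) ∈ Gᗮᗮ := by
    rw [Submodule.mem_orthogonal]
    intro u hu
    rw [Submodule.mem_orthogonal] at hu
    have h1 : ∀ x : F.domain, inner ℂ (-u.fst) (x : H) = inner ℂ u.snd (F x) := fun x => by
      have h2 := hu (WithLp.toLp 2 ((x : H), F x)) (F.mem_graph x)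
      rw [WithLp.prod_inner_apply] at h2
      have h3 := congrArg conj h2
      rw [map_add, inner_conj_symm, inner_conj_symm, map_zero] at h3
      rw [inner_neg_left]
      exact neg_eq_of_add_eq_zero_right h3
    have h2 : u.snd ∈ F†.domain := F.mem_adjoint_domain_of_exists _ ⟨_, h1⟩
    have h3 := (Submodule.mem_orthogonal _ _).1 hy _ h2
    rw [WithLp.prod_inner_apply]
    change inner ℂ u.fst (0 : H) + inner ℂ u.snd y = 0
    rw [h3, inner_zero_right, add_zero]
  rw [Submodule.orthogonal_orthogonal] at hmem
  obtain ⟨x, hx, hx'⟩ := F.mem_graph_iff.1 (show ((0 : H), y) ∈ F.graph from hmem)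
  have : x = 0 := Subtype.ext hx
  rw [this, LinearPMap.map_zero] at hx'
  exact hx'.symm

section Resolvent

variable {T : H →ₗ.[ℂ] H}

theorem isFormalAdjoint_self (hT : IsSelfAdjoint T) : T.IsFormalAdjoint T := by
  have h := LinearPMap.adjoint_isFormalAdjoint hT.dense_domain
  rwa [LinearPMap.isSelfAdjoint_def.1 hT] at h

/-- Symmetry makes $\langle Tx,x\rangle$ real. The sign is $+\operatorname{Im}z$ because the inner
product is conjugate-linear in its first argument. -/
theorem im_inner_apply_sub_smul (hT : IsSelfAdjoint T) (z : ℂ) (x : T.domain) :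
    (inner ℂ (T x - z • (x : H)) (x : H)).im = z.im * ‖(x : H)‖ ^ 2 := by
  have h1 : (inner ℂ (T x) (x : H)).im = 0 := by
    have h2 : conj (inner ℂ (T x) (x : H)) = inner ℂ (T x) (x : H) := by
      rw [inner_conj_symm, isFormalAdjoint_self hT x x]
    exact Complex.conj_eq_iff_im.1 h2
  rw [inner_sub_left, inner_smul_left, inner_self_eq_norm_sq_to_K, Complex.sub_im, h1]
  have : (conj z * ((‖(x : H)‖ : ℂ)) ^ 2).im = -z.im * ‖(x : H)‖ ^ 2 := by
    rw [← Complex.ofReal_pow, mul_comm, Complex.im_ofReal_mul, Complex.conj_im]; ring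
  change 0 - (conj z * ((‖(x : H)‖ : ℂ)) ^ 2).im = _
  rw [this]; ring

theorem norm_le_norm_apply_sub_smul (hT : IsSelfAdjoint T) (z : ℂ) (x : T.domain) :
    |z.im| * ‖(x : H)‖ ≤ ‖T x - z • (x : H)‖ := by
  rcases eq_or_ne ‖(x : H)‖ 0 with h | h
  · rw [h, mul_zero]; exact norm_nonneg _
  · have hpos : 0 < ‖(x : H)‖ := lt_of_le_of_ne (norm_nonneg _) h.symm
    have h1 := congrArg abs (im_inner_apply_sub_smul hT z x)
    rw [abs_mul, abs_of_nonneg (sq_nonneg ‖(x : H)‖)] at h1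
    have h2 := (Complex.abs_im_le_norm _).trans (norm_inner_le_norm (𝕜 := ℂ) (T x - z • (x : H)) x)
    rw [h1] at h2
    nlinarith

/-- A self-adjoint operator minus a non-real number is a bijection of the domain onto the space. -/
theorem bijective_apply_sub_smul (hT : IsSelfAdjoint T) {z : ℂ} (hz : z.im ≠ 0) :
    Function.Bijective fun x : T.domain => T x - z • (x : H) := by
  let L : T.domain →ₗ[ℂ] H := T.toFun - z • T.domain.subtype
  have hL : ∀ x : T.domain, L x = T x - z • (x : H) := fun x => rfl
  have hz' : 0 < |z.im| := abs_pos.2 hz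
  have hinj : Function.Injective L := (injective_iff_map_eq_zero L).2 fun x hx => by
    have := norm_le_norm_apply_sub_smul hT z x
    rw [← hL, hx, norm_zero] at this
    have h0 : ‖(x : H)‖ = 0 := le_antisymm (nonpos_of_mul_nonpos_right this hz') (norm_nonneg _)
    exact Subtype.ext (norm_eq_zero.1 h0)
  have hclosed : IsClosed (LinearMap.range L : Set H) := by
    refine isClosed_of_closure_subset fun y hy => ?_
    obtain ⟨u, hu, huy⟩ := mem_closure_iff_seq_limit.1 hy
    choose x hx using hu
    have hcau : CauchySeq fun n => (x n : H) := by
      have h1 := huy.cauchySeq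
      rw [Metric.cauchySeq_iff] at h1 ⊢
      intro ε hε
      obtain ⟨n₀, hn₀⟩ := h1 (|z.im| * ε) (by positivity)
      refine ⟨n₀, fun m hm n hn => ?_⟩
      have h2 := hn₀ m hm n hn
      rw [dist_eq_norm, ← hx, ← hx, ← map_sub, hL] at h2
      have h3 := (norm_le_norm_apply_sub_smul hT z (x m - x n)).trans_lt h2
      rw [dist_eq_norm]
      exact lt_of_mul_lt_mul_left h3 hz'.le
    obtain ⟨x₀, hx₀⟩ := cauchySeq_tendsto_of_complete hcau
    have hT' : Filter.Tendsto (fun n => T (x n)) Filter.atTop (nhds (y + z • x₀)) := by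
      have h1 := huy.add (hx₀.const_smul z)
      refine h1.congr fun n => ?_
      rw [← hx, hL, sub_add_cancel]
    have hgr : (x₀, y + z • x₀) ∈ T.graph := by
      have hcl : IsClosed (T.graph : Set (H × H)) := hT.isClosed
      exact hcl.mem_of_tendsto (hx₀.prodMk_nhds hT') (Filter.Eventually.of_forall fun n =>
        T.mem_graph (x n))
    obtain ⟨w, hw, hw'⟩ := T.mem_graph_iff.1 hgr
    exact ⟨w, by rw [hL, hw', hw]; simp⟩
  -- A vector orthogonal to the range is in the kernel of $T^*-\bar z=T-\bar z$, which is trivial by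
  -- the same lower bound.
  have hdense : (LinearMap.range L)ᗮ = ⊥ := by
    rw [Submodule.eq_bot_iff]
    intro y hy
    have h1 : ∀ x : T.domain, inner ℂ (conj z • y) (x : H) = inner ℂ y (T x) := fun x => by
      have h2 : inner ℂ y (L x) = 0 := Submodule.inner_left_of_mem_orthogonal (LinearMap.mem_range_self L x) hy
      rw [hL, inner_sub_right, inner_smul_right, sub_eq_zero] at h2
      rw [inner_smul_left, Complex.conj_conj, h2]
    have h2 : y ∈ T†.domain := T.mem_adjoint_domain_of_exists _ ⟨_, h1⟩
    have h3 : T† ⟨y, h2⟩ = conj z • y := LinearPMap.adjoint_apply_eq hT.dense_domain _ h1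
    have h4 : (y, conj z • y) ∈ T†.graph := (LinearPMap.mem_graph_iff _).2 ⟨⟨y, h2⟩, rfl, h3⟩
    rw [LinearPMap.isSelfAdjoint_def.1 hT] at h4
    obtain ⟨w, hw, hw'⟩ := T.mem_graph_iff.1 h4
    have h5 := norm_le_norm_apply_sub_smul hT (conj z) w
    simp only [hw', hw, sub_self, norm_zero, Complex.conj_im, abs_neg] at h5
    exact norm_eq_zero.1 (le_antisymm (nonpos_of_mul_nonpos_right h5 hz') (norm_nonneg _))
  refine ⟨hinj, fun y => ?_⟩
  have : CompleteSpace (LinearMap.range L) := hclosed.completeSpace_coe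
  have htop : LinearMap.range L = ⊤ := Submodule.orthogonal_eq_bot_iff.1 hdense
  obtain ⟨x, hx⟩ := LinearMap.range_eq_top.1 htop y
  exact ⟨x, hx⟩

theorem apply_resolventMap_sub_smul (hT : IsSelfAdjoint T) {z : ℂ} (hz : z.im ≠ 0) (y : H) :
    T (resolventMap T z y) - z • (resolventMap T z y : H) = y :=
  Function.rightInverse_invFun (bijective_apply_sub_smul hT hz).2 y

theorem resolventMap_eq (hT : IsSelfAdjoint T) {z : ℂ} (hz : z.im ≠ 0) {y : H} {x : T.domain}
    (hx : T x - z • (x : H) = y) : resolventMap T z y = x :=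
  (bijective_apply_sub_smul hT hz).1 ((apply_resolventMap_sub_smul hT hz y).trans hx.symm)

theorem inner_resolventMap (hT : IsSelfAdjoint T) {z : ℂ} (hz : z.im ≠ 0) (x y : H) :
    inner ℂ (resolventMap T z x : H) y = inner ℂ x (resolventMap T (conj z) y : H) := by
  have hz' : (conj z).im ≠ 0 := by simpa using hz
  have h1 := apply_resolventMap_sub_smul hT hz x
  have h2 := apply_resolventMap_sub_smul hT hz' y
  conv_lhs => rw [← h2]
  conv_rhs => rw [← h1]
  rw [inner_sub_left, inner_sub_right, inner_smul_left, inner_smul_right,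
    isFormalAdjoint_self hT]

end Resolvent

end Unbounded

/-! ### The sandwiched resolvent -/

namespace PerturbationData

variable {H K : Type*} [NormedAddCommGroup H] [InnerProductSpace ℂ H] [CompleteSpace H]
  [NormedAddCommGroup K] [InnerProductSpace ℂ K] [CompleteSpace K]
  {D : PerturbationData H K}

theorem Admissible.dense_adjoint (hD : D.Admissible) : Dense (D.F†.domain : Set K) :=
  dense_adjoint_domain hD.closed_F

theorem Admissible.extends_T (hD : D.Admissible) {z : ℂ} (hz : z.im ≠ 0) (s : ℝ) :
    D.ExtendsSandwichedResolvent z s (D.T z s) := by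
  have h : ∃ T : K →L[ℂ] K, D.ExtendsSandwichedResolvent z s T :=
    (hD.compact_T z s hz).imp fun _ h => h.1
  rw [PerturbationData.T, dif_pos h]
  exact h.choose_spec

theorem Admissible.isCompactOperator_T (hD : D.Admissible) {z : ℂ} (hz : z.im ≠ 0) (s : ℝ) :
    IsCompactOperator (D.T z s) := by
  obtain ⟨T', h1, h2⟩ := hD.compact_T z s hz
  have : (D.T z s : K → K) = T' :=
    Continuous.ext_on hD.dense_adjoint (D.T z s).continuous T'.continuous fun φ hφ =>
      (hD.extends_T hz s ⟨φ, hφ⟩).trans (h1 ⟨φ, hφ⟩).symm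
  rw [this]; exact h2

/-- The vector `R_z(H_s) F* φ` as an element of the domain of `F`. -/
def resolventAdj (D : PerturbationData H K) (z : ℂ) (s : ℝ) (φ : D.F†.domain) : D.F.domain :=
  ⟨(resolventMap (D.Hs s) z (D.F† φ) : H), D.mem_domain_F _⟩

theorem Admissible.T_apply (hD : D.Admissible) {z : ℂ} (hz : z.im ≠ 0) (s : ℝ)
    (φ : D.F†.domain) : D.T z s φ = D.F (D.resolventAdj z s φ) :=
  hD.extends_T hz s φ

theorem Admissible.inner_adjoint (hD : D.Admissible) (φ : D.F†.domain) (x : D.F.domain) :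
    inner ℂ (φ : K) (D.F x) = inner ℂ (D.F† φ) (x : H) :=
  (LinearPMap.adjoint_isFormalAdjoint hD.dense_F φ x).symm

/-- On $\operatorname{dom}F^*$ this is $R_z(H_s)^*=R_{\bar z}(H_s)$; density extends it in one
argument at a time. -/
theorem Admissible.adjoint_T (hD : D.Admissible) {z : ℂ} (hz : z.im ≠ 0) (s : ℝ) :
    ContinuousLinearMap.adjoint (D.T z s) = D.T (conj z) s := by
  have hz' : (conj z).im ≠ 0 := by simpa using hz
  symm
  rw [ContinuousLinearMap.eq_adjoint_iff]
  have key : ∀ φ ∈ D.F†.domain, ∀ ψ ∈ D.F†.domain,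
      inner ℂ (D.T (conj z) s φ) ψ = inner ℂ φ (D.T z s ψ) := fun φ hφ ψ hψ => by
    have e1 : D.T (conj z) s φ = D.F (D.resolventAdj (conj z) s ⟨φ, hφ⟩) := hD.T_apply hz' s ⟨φ, hφ⟩
    have e2 : D.T z s ψ = D.F (D.resolventAdj z s ⟨ψ, hψ⟩) := hD.T_apply hz s ⟨ψ, hψ⟩
    have e3 := hD.inner_adjoint ⟨φ, hφ⟩ (D.resolventAdj z s ⟨ψ, hψ⟩)
    have e4 := hD.inner_adjoint ⟨ψ, hψ⟩ (D.resolventAdj (conj z) s ⟨φ, hφ⟩)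
    rw [e1, e2, e3, ← inner_conj_symm, e4, inner_conj_symm]
    have := inner_resolventMap (hD.selfAdjoint_Hs s) hz' (D.F† ⟨φ, hφ⟩) (D.F† ⟨ψ, hψ⟩)
    rw [Complex.conj_conj] at this
    exact this
  have key' : ∀ φ ∈ D.F†.domain, ∀ ψ, inner ℂ (D.T (conj z) s φ) ψ = inner ℂ φ (D.T z s ψ) :=
    fun φ hφ ψ => congrFun (Continuous.ext_on hD.dense_adjoint (by fun_prop) (by fun_prop)
      (key φ hφ)) ψ
  exact fun φ ψ => congrFun (Continuous.ext_on hD.dense_adjoint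
    (f := fun φ => inner ℂ (D.T (conj z) s φ) ψ) (g := fun φ => inner ℂ φ (D.T z s ψ))
    (by fun_prop) (by fun_prop) fun φ hφ => key' φ hφ ψ) φ

/-- With $x=R_z(H_s)F^*\varphi$ one has $\langle\varphi,T_z(H_s)\varphi\rangle=\langle
F^*\varphi,x\rangle=\langle(H_s-z)x,x\rangle$. -/
theorem Admissible.im_inner_T_of_mem (hD : D.Admissible) {z : ℂ} (hz : z.im ≠ 0) (s : ℝ)
    (φ : D.F†.domain) :
    (inner ℂ (φ : K) (D.T z s φ)).im = z.im * ‖(D.resolventAdj z s φ : H)‖ ^ 2 := by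
  rw [hD.T_apply hz, hD.inner_adjoint]
  have h := im_inner_apply_sub_smul (hD.selfAdjoint_Hs s) z (resolventMap (D.Hs s) z (D.F† φ))
  rw [apply_resolventMap_sub_smul (hD.selfAdjoint_Hs s) hz] at h
  exact h

/-- `(Im z) Im T_z(H_s) ≥ 0`, and the form vanishes only on the kernel of `T_z(H_s)`. -/
theorem Admissible.im_inner_T_pos (hD : D.Admissible) {z : ℂ} (hz : z.im ≠ 0) (s : ℝ) {φ : K}
    (hφ : D.T z s φ ≠ 0) : 0 < z.im * (inner ℂ φ (D.T z s φ)).im := by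
  obtain ⟨f, hf, hfφ⟩ := mem_closure_iff_seq_limit.1 (hD.dense_adjoint φ)
  have hT : Filter.Tendsto (fun n => D.T z s (f n)) Filter.atTop (nhds (D.T z s φ)) :=
    ((D.T z s).continuous.tendsto φ).comp hfφ
  let x : ℕ → D.F.domain := fun n => D.resolventAdj z s ⟨f n, hf n⟩
  have hx : ∀ n, D.T z s (f n) = D.F (x n) := fun n => hD.T_apply hz s ⟨f n, hf n⟩
  have hlim : Filter.Tendsto (fun n => z.im ^ 2 * ‖(x n : H)‖ ^ 2) Filter.atTop
      (nhds (z.im * (inner ℂ φ (D.T z s φ)).im)) := by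
    have h1 := (Complex.continuous_im.tendsto _).comp (hfφ.inner hT) |>.const_mul z.im
    refine h1.congr fun n => ?_
    have := hD.im_inner_T_of_mem hz s ⟨f n, hf n⟩
    change z.im * (inner ℂ (f n) (D.T z s (f n))).im = _
    rw [this]; ring
  -- If the limit is 0, then $x_n\to0$ while $Fx_n\to T_z(H_s)\varphi$; closedness of $F$ forces
  -- $T_z(H_s)\varphi=0$.
  refine lt_of_le_of_ne (ge_of_tendsto' hlim fun n => by positivity) fun h0 => hφ ?_
  rw [← h0] at hlim
  have hx0 : Filter.Tendsto (fun n => (x n : H)) Filter.atTop (nhds 0) := by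
    rw [tendsto_zero_iff_norm_tendsto_zero]
    have h1 := (Real.continuous_sqrt.tendsto 0).comp hlim |>.const_mul |z.im|⁻¹
    rw [Real.sqrt_zero, mul_zero] at h1
    refine h1.congr fun n => ?_
    simp only [Function.comp]
    rw [← mul_pow, Real.sqrt_sq_eq_abs, abs_mul, abs_norm,
      inv_mul_cancel_left₀ (abs_ne_zero.2 hz)]
  have hgr : ((0 : H), D.T z s φ) ∈ D.F.graph := by
    have hcl : IsClosed (D.F.graph : Set (H × K)) := hD.closed_F
    refine hcl.mem_of_tendsto (hx0.prodMk_nhds hT) (Filter.Eventually.of_forall fun n => ?_)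
    change ((x n : H), D.T z s (f n)) ∈ D.F.graph
    rw [hx]; exact D.F.mem_graph (x n)
  obtain ⟨w, hw, hw'⟩ := D.F.mem_graph_iff.1 hgr
  have : w = 0 := Subtype.ext hw
  rw [this, LinearPMap.map_zero] at hw'
  exact hw'.symm

/-- The second resolvent identity. -/
theorem Admissible.T_sub_T (hD : D.Admissible) {z : ℂ} (hz : z.im ≠ 0) (s t : ℝ) :
    D.T z s - D.T z t = ((t : ℂ) - s) • (D.T z s * D.J * D.T z t) := by
  refine DFunLike.coe_injective (Continuous.ext_on hD.dense_adjoint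
    (ContinuousLinearMap.continuous _) (ContinuousLinearMap.continuous _) fun φ hφ => ?_)
  set x := resolventMap (D.Hs t) z (D.F† ⟨φ, hφ⟩) with hxdef
  have hxH : (x : H) ∈ D.H₀.domain := x.2.1
  have hxV : (x : H) ∈ D.V.domain := x.2.2
  have hxs : (x : H) ∈ (D.Hs s).domain := ⟨hxH, hxV⟩
  have hxt : D.T z t φ = D.F (D.resolventAdj z t ⟨φ, hφ⟩) := hD.T_apply hz t ⟨φ, hφ⟩
  have hψ : D.J (D.T z t φ) ∈ D.F†.domain := by
    rw [hxt]; exact hxV.choose_spec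
  have hV : D.V ⟨x, hxV⟩ = D.F† ⟨D.J (D.T z t φ), hψ⟩ := by
    change D.F† _ = _
    congr 1
    exact Subtype.ext (congrArg D.J hxt.symm)
  have hHs : ∀ r : ℝ, ∀ hr : (x : H) ∈ (D.Hs r).domain,
      D.Hs r ⟨x, hr⟩ = D.H₀ ⟨x, hxH⟩ + (r : ℂ) • D.V ⟨x, hxV⟩ := fun r hr => rfl
  have h1 : D.Hs t x - z • (x : H) = D.F† ⟨φ, hφ⟩ :=
    apply_resolventMap_sub_smul (hD.selfAdjoint_Hs t) hz _
  have h1' : D.H₀ ⟨x, hxH⟩ + (t : ℂ) • D.V ⟨x, hxV⟩ - z • (x : H) = D.F† ⟨φ, hφ⟩ := h1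
  set y := resolventMap (D.Hs s) z (D.F† ⟨D.J (D.T z t φ), hψ⟩) with hydef
  have h2 : D.Hs s y - z • (y : H) = D.F† ⟨D.J (D.T z t φ), hψ⟩ :=
    apply_resolventMap_sub_smul (hD.selfAdjoint_Hs s) hz _
  -- $(H_s-z)x=F^*\varphi+(s-t)Vx$, where $Vx=F^*JT_z(H_t)\varphi$; the term $(t-s)y$ cancels the
  -- excess.
  have h3 : resolventMap (D.Hs s) z (D.F† ⟨φ, hφ⟩) =
      (⟨x, hxs⟩ : (D.Hs s).domain) + ((t : ℂ) - s) • y := by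
    refine resolventMap_eq (hD.selfAdjoint_Hs s) hz ?_
    rw [LinearPMap.map_add, LinearPMap.map_smul, Submodule.coe_add, Submodule.coe_smul, hHs s,
      ← h1', sub_eq_iff_eq_add.1 h2, hV]
    module
  have e1 : D.T z s φ = D.F (D.resolventAdj z s ⟨φ, hφ⟩) := hD.T_apply hz s ⟨φ, hφ⟩
  have e2 : D.T z s (D.J (D.T z t φ)) = D.F (D.resolventAdj z s ⟨D.J (D.T z t φ), hψ⟩) :=
    hD.T_apply hz s ⟨D.J (D.T z t φ), hψ⟩
  have e3 : D.resolventAdj z s ⟨φ, hφ⟩ = D.resolventAdj z t ⟨φ, hφ⟩ +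
      ((t : ℂ) - s) • D.resolventAdj z s ⟨D.J (D.T z t φ), hψ⟩ :=
    Subtype.ext (by have := congrArg Subtype.val h3; exact this)
  change D.T z s φ - D.T z t φ = ((t : ℂ) - s) • D.T z s (D.J (D.T z t φ))
  rw [e1, e2, e3, LinearPMap.map_add, LinearPMap.map_smul, ← hxt]
  abel

end PerturbationData

/-! ### Finite-rank operators -/

section FiniteRank

variable {K : Type*} [NormedAddCommGroup K] [InnerProductSpace ℂ K] [CompleteSpace K]

omit [CompleteSpace K] in
theorem IsFiniteRank.sum {ι : Type*} {f : ι → K →L[ℂ] K} (s : Finset ι)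
    (hf : ∀ i ∈ s, IsFiniteRank (f i)) : IsFiniteRank (∑ i ∈ s, f i) := by
  classical
  induction s using Finset.induction_on with
  | empty =>
    have : LinearMap.range ((0 : K →L[ℂ] K) : K →ₗ[ℂ] K) = ⊥ := LinearMap.range_zero
    rw [Finset.sum_empty, IsFiniteRank, this]
    infer_instance
  | insert i s hi ih =>
    have h1 : FiniteDimensional ℂ (LinearMap.range (f i : K →ₗ[ℂ] K)) :=
      hf i (Finset.mem_insert_self i s)
    have h2 : FiniteDimensional ℂ (LinearMap.range ((∑ j ∈ s, f j : K →L[ℂ] K) : K →ₗ[ℂ] K)) :=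
      ih fun j hj => hf j (Finset.mem_insert_of_mem hj)
    rw [Finset.sum_insert hi]
    refine Submodule.finiteDimensional_of_le (S₂ := LinearMap.range (f i : K →ₗ[ℂ] K) ⊔
      LinearMap.range ((∑ j ∈ s, f j : K →L[ℂ] K) : K →ₗ[ℂ] K)) ?_
    rintro _ ⟨x, rfl⟩
    exact Submodule.add_mem_sup ⟨x, rfl⟩ ⟨x, rfl⟩

omit [CompleteSpace K] in
theorem IsFiniteRank.mul_left {P : K →L[ℂ] K} (hP : IsFiniteRank P) (C : K →L[ℂ] K) :
    IsFiniteRank (C * P) := by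
  have : FiniteDimensional ℂ (LinearMap.range (P : K →ₗ[ℂ] K)) := hP
  refine Submodule.finiteDimensional_of_le
    (S₂ := (LinearMap.range (P : K →ₗ[ℂ] K)).map (C : K →ₗ[ℂ] K)) ?_
  rintro _ ⟨x, rfl⟩
  exact ⟨P x, ⟨x, rfl⟩, rfl⟩

end FiniteRank

/-! ### Resonance points and their idempotents -/

namespace PerturbationData

variable {H K : Type*} [NormedAddCommGroup H] [InnerProductSpace ℂ H] [CompleteSpace H]
  [NormedAddCommGroup K] [InnerProductSpace ℂ K] [CompleteSpace K]
  {D : PerturbationData H K}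

open ContinuousLinearMap

theorem Admissible.A_sub_A (hD : D.Admissible) {z : ℂ} (hz : z.im ≠ 0) (s t : ℝ) :
    D.A z s - D.A z t = ((t : ℂ) - s) • (D.A z s * D.A z t) := by
  have h := congrArg (· * D.J) (hD.T_sub_T hz s t)
  simp only [sub_mul, smul_mul_assoc] at h
  exact h

theorem Admissible.star_A (hD : D.Admissible) {z : ℂ} (hz : z.im ≠ 0) (s : ℝ) :
    star (D.A z s) = D.B (conj z) s := by
  have h1 : star D.J = D.J := hD.selfAdjoint_J
  have h2 : star (D.T z s) = D.T (conj z) s := hD.adjoint_T hz s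
  change star (D.T z s * D.J) = D.J * D.T (conj z) s
  rw [star_mul, h1, h2]

theorem Admissible.biCompact_A (hD : D.Admissible) {z : ℂ} (hz : z.im ≠ 0) (s : ℝ) :
    BiCompact (D.A z s) := by
  have hz' : (conj z).im ≠ 0 := by simpa using hz
  refine ⟨(hD.isCompactOperator_T hz s).comp_clm D.J, ?_⟩
  have : adjoint (D.A z s) = D.B (conj z) s := hD.star_A hz s
  rw [this]
  exact (hD.isCompactOperator_T hz' s).clm_comp D.J

/-- Resonance points corresponding to non-real numbers are not real. -/
theorem Admissible.im_ne_zero_of_isResonancePoint (hD : D.Admissible) {z r : ℂ} (hz : z.im ≠ 0)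
    (hr : D.IsResonancePoint z r) : r.im ≠ 0 := by
  obtain ⟨s, u, hu, h⟩ := hr
  intro him
  obtain ⟨ρ, hρ⟩ : ∃ ρ : ℝ, r - s = (ρ : ℂ) :=
    ⟨r.re - s, by apply Complex.ext <;> simp [him]⟩
  rw [hρ] at h
  have hT : D.T z s (D.J u) ≠ 0 := fun h0 => hu (by
    have : D.A z s u = 0 := h0
    rwa [this, smul_zero, add_zero] at h)
  have hρ0 : ρ ≠ 0 := fun h0 => hu (by simpa [h0] using h)
  have h1 := hD.im_inner_T_pos hz s hT
  have h2 : (inner ℂ (D.J u) u).im = 0 := by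
    have := hD.selfAdjoint_J.isSymmetric.im_inner_self_apply u
    rw [← inner_conj_symm, Complex.conj_im]
    exact neg_eq_zero.2 this
  -- Pair the resonance equation with $Ju$: the first term is real, so for real $\rho\ne0$ the
  -- imaginary part of $\langle Ju,T_z(H_s)Ju\rangle$ would vanish.
  have h3 : inner ℂ (D.J u) u + (ρ : ℂ) * inner ℂ (D.J u) (D.T z s (D.J u)) = 0 := by
    rw [← inner_smul_right, ← inner_add_right]
    exact (congrArg (inner ℂ (D.J u)) h).trans (inner_zero_right _)
  have h4 := congrArg Complex.im h3
  rw [Complex.add_im, h2, Complex.im_ofReal_mul, zero_add, Complex.zero_im] at h4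
  rw [(mul_eq_zero.1 h4).resolve_left hρ0, mul_zero] at h1
  exact lt_irrefl _ h1

theorem ofReal_sub_ne_zero {r : ℂ} (hr : r.im ≠ 0) (t : ℝ) : (t : ℂ) - r ≠ 0 := fun h => hr (by
  rw [← sub_eq_zero.1 h, Complex.ofReal_im])

/-- The Riesz decompositions of `A_z(t)` at `(t - r)⁻¹` have the same idempotent for all `t`. -/
theorem Admissible.exists_isFitting (hD : D.Admissible) {z r : ℂ} (hz : z.im ≠ 0)
    (hr : r.im ≠ 0) : ∃ P : K →L[ℂ] K, IsFiniteRank P ∧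
      ∀ t : ℝ, ∃ (n : ℕ) (S : K →L[ℂ] K), IsFitting (D.A z t - ((t : ℂ) - r)⁻¹ • 1) P S n := by
  have hne := ofReal_sub_ne_zero hr
  obtain ⟨n, P, S, hP, hfin⟩ := exists_isFitting_of_biCompact (hD.biCompact_A hz 0)
    (inv_ne_zero (hne 0))
  refine ⟨P, hfin, fun t => ?_⟩
  set A := D.A z 0 with hA
  set A' := D.A z t with hA'
  have e1 : A - A' = (t : ℂ) • (A * A') := by simpa using hD.A_sub_A hz 0 t
  have e2 : A' - A = (-t : ℂ) • (A' * A) := by simpa using hD.A_sub_A hz t 0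
  -- The resolvent identity says that $1+tA_z(0)$ has inverse $1-tA_z(t)$, so $A_z(t)=A_z(0)E^{-1}$.
  let E : (K →L[ℂ] K)ˣ :=
    { val := 1 + (t : ℂ) • A
      inv := 1 - (t : ℂ) • A'
      val_inv := by
        have : (1 + (t : ℂ) • A) * (1 - (t : ℂ) • A') =
            1 + (t : ℂ) • ((A - A') - (t : ℂ) • (A * A')) := by
          simp only [add_mul, mul_sub, one_mul, mul_one, smul_mul_assoc, mul_smul_comm]
          module
        rw [this, e1, sub_self, smul_zero, add_zero]
      inv_val := by
        have : (1 - (t : ℂ) • A') * (1 + (t : ℂ) • A) =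
            1 - (t : ℂ) • ((A' - A) - (-t : ℂ) • (A' * A)) := by
          simp only [sub_mul, mul_add, one_mul, mul_one, smul_mul_assoc, mul_smul_comm]
          module
        rw [this, e2, sub_self, smul_zero, sub_zero] }
  have hEval : (E : K →L[ℂ] K) = 1 + (t : ℂ) • A := rfl
  have hEA : Commute (E : K →L[ℂ] K) A :=
    (Commute.one_left A).add_left ((Commute.refl A).smul_left _)
  have hAP : Commute A P := by
    have h1 : Commute (A - (((0 : ℝ) : ℂ) - r)⁻¹ • 1) P := hP.comm
    have h2 : Commute ((((0 : ℝ) : ℂ) - r)⁻¹ • (1 : K →L[ℂ] K)) P :=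
      (Commute.one_left P).smul_left _
    simpa using h1.add_left h2
  -- The factor comes from $A_z(t)-(t-r)^{-1}=\frac{-r}{t-r}\bigl(A_z(0)-(-r)^{-1}\bigr)E^{-1}$; it
  -- is non-zero because $r$ is not real.
  have hc : (-r) / (t - r) ≠ 0 := div_ne_zero (by simpa using hne 0) (hne t)
  have key := hP.smul_mul_unit_inv hc E
    (hEA.sub_right ((Commute.one_right _).smul_right _))
    ((Commute.one_left P).add_left (hAP.smul_left _))
  suffices h : A' - ((t : ℂ) - r)⁻¹ • 1 =
      (-r / (t - r)) • ((A - (((0 : ℝ) : ℂ) - r)⁻¹ • 1) * ↑E⁻¹) from ⟨n, _, h ▸ key⟩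
  rw [← smul_mul_assoc, Units.eq_mul_inv_iff_mul_eq, hEval]
  have h0 : r ≠ 0 := fun h => hr (by simp [h])
  have ht := hne t
  have e3 : A' + (t : ℂ) • (A' * A) = A := by
    rw [neg_smul] at e2
    rw [← sub_eq_zero, ← sub_eq_zero.2 e2]; abel
  have e4 : (A' - ((t : ℂ) - r)⁻¹ • 1) * (1 + (t : ℂ) • A) =
      (A' + (t : ℂ) • (A' * A)) - ((t : ℂ) - r)⁻¹ • (1 + (t : ℂ) • A) := by
    simp only [sub_mul, mul_add, mul_one, smul_mul_assoc, one_mul, mul_smul_comm]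
    module
  rw [e4, e3, smul_add, smul_sub, smul_smul, smul_smul, ← sub_sub]
  have c1 : (-r) / (t - r) = 1 - ((t : ℂ) - r)⁻¹ * t := by field_simp; ring
  have c2 : (-r) / (t - r) * (((0 : ℝ) : ℂ) - r)⁻¹ = ((t : ℂ) - r)⁻¹ := by
    simp only [Complex.ofReal_zero, zero_sub]; field_simp
  rw [c2, c1, sub_smul, one_smul]
  abel

end PerturbationData

end ResonanceIndex

end

/-! ### The main theorem -/

theorem theoremT {H K : Type*}
    [NormedAddCommGroup H] [InnerProductSpace ℂ H] [CompleteSpace H]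
    [NormedAddCommGroup K] [InnerProductSpace ℂ K] [CompleteSpace K]
    (D : ResonanceIndex.PerturbationData H K) (hD : D.Admissible)
    (z : ℂ) (hz : z.im ≠ 0)
    (Γ : Finset ℂ) (hΓ : ∀ r ∈ Γ, D.IsResonancePoint z r)
    (s t t' : ℝ) :
    let M : K →L[ℂ] K := D.QSet (conj z) t' (Γ.image conj) ∘L D.J ∘L D.PSet z t Γ
    let N : K →L[ℂ] K := (z.im : ℂ) • (D.A z s ∘L D.PSet z t Γ)
    (ResonanceIndex.IsFiniteRank M ∧ IsSelfAdjoint M) ∧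
      ResonanceIndex.IsClassR N ∧
      ResonanceIndex.signature M = ResonanceIndex.rIndex N := by
  intro M N
  have him : ∀ r ∈ Γ, r.im ≠ 0 := fun r hr => hD.im_ne_zero_of_isResonancePoint hz (hΓ r hr)
  -- One idempotent $p(r)$ serves every real parameter, so $t$, $t'$ and $s$ can be used side by
  -- side below.
  obtain ⟨p, hp⟩ : ∃ p : ℂ → K →L[ℂ] K, ∀ r ∈ Γ, ResonanceIndex.IsFiniteRank (p r) ∧
      ∀ t : ℝ, ∃ (n : ℕ) (S : K →L[ℂ] K),
        ResonanceIndex.IsFitting (D.A z t - ((t : ℂ) - r)⁻¹ • 1) (p r) S n := by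
    choose! p hp using fun (r : ℂ) (hr : r ∈ Γ) => hD.exists_isFitting hz (him r hr)
    exact ⟨p, hp⟩
  obtain ⟨P, hP⟩ : ∃ P, P = ∑ r ∈ Γ, p r := ⟨_, rfl⟩
  have hPSet : D.PSet z t Γ = P := by
    rw [hP]
    refine Finset.sum_congr rfl fun r hr => ?_
    obtain ⟨n, S, h⟩ := (hp r hr).2 t
    exact h.rieszIdempotent_eq
  have hQSet : D.QSet (conj z) t' (Γ.image conj) = star P := by
    rw [hP, star_sum, ResonanceIndex.PerturbationData.QSet,
      Finset.sum_image ((starRingEnd ℂ).injective.injOn)]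
    refine Finset.sum_congr rfl fun r hr => ?_
    obtain ⟨n, S, h⟩ := (hp r hr).2 t'
    have h' := h.star
    rw [star_sub, star_smul, star_one, hD.star_A hz] at h'
    have hconj : star (((t' : ℂ) - r)⁻¹) = ((t' : ℂ) - conj r)⁻¹ := by simp
    rw [hconj] at h'
    exact h'.rieszIdempotent_eq
  have hmul : ∀ i ∈ Γ, ∀ j ∈ Γ, i ≠ j → p i * p j = 0 := fun i hi j hj hij => by
    obtain ⟨n, S, h⟩ := (hp i hi).2 s
    obtain ⟨n', S', h'⟩ := (hp j hj).2 s
    refine h.mul_eq_zero (fun heq => hij ?_) h'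
    exact sub_right_injective (inv_injective heq)
  have hmulP : ∀ i ∈ Γ, p i * P = p i := fun i hi => by
    obtain ⟨n, S, h⟩ := (hp i hi).2 s
    rw [hP, Finset.mul_sum, Finset.sum_eq_single_of_mem i hi fun j hj hji => hmul i hi j hj hji.symm,
      h.idem]
  have hPP : P * P = P := by
    conv_lhs => enter [1]; rw [hP]
    rw [Finset.sum_mul, Finset.sum_congr rfl hmulP, hP]
  have hfin : ResonanceIndex.IsFiniteRank P := hP ▸
    ResonanceIndex.IsFiniteRank.sum Γ fun r hr => (hp r hr).1
  have hcomm : ∀ r ∈ Γ, Commute (D.A z s) (p r) := fun r hr => by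
    obtain ⟨n, S, h⟩ := (hp r hr).2 s
    have h1 : Commute (D.A z s - ((s : ℂ) - r)⁻¹ • 1) (p r) := h.comm
    have h2 : Commute (((s : ℂ) - r)⁻¹ • (1 : K →L[ℂ] K)) (p r) :=
      (Commute.one_left _).smul_left _
    simpa using h1.add_left h2
  have hAP : Commute (D.A z s) P := hP ▸ Commute.sum_right _ _ _ hcomm
  have hM : M = star P * D.J * P := by
    simp only [M, hPSet, hQSet]; rfl
  have hN : N = (z.im : ℂ) • (D.A z s * P) := by
    simp only [N, hPSet]; rfl
  have hPN : P * N = N := by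
    rw [hN, mul_smul_comm, ← mul_assoc, ← hAP.eq, mul_assoc, hPP]
  -- $A_z(s)$ commutes with each $p(r)$ and is injective on its range, where its only spectral value
  -- is $(s-r)^{-1}\ne0$.
  have hinj : ∀ u ∈ LinearMap.range (P : K →ₗ[ℂ] K), D.A z s u = 0 → u = 0 := by
    rintro _ ⟨f, rfl⟩ hu
    change D.A z s (P f) = 0 at hu
    change P f = 0
    have h0 : ∀ r ∈ Γ, p r f = 0 := fun r hr => by
      obtain ⟨n, S, h⟩ := (hp r hr).2 s
      refine h.eq_zero_of_apply_eq_zero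
        (inv_ne_zero (ResonanceIndex.PerturbationData.ofReal_sub_ne_zero (him r hr) s)) ?_
      have h1 : D.A z s * p r = p r * (D.A z s * P) := by
        rw [← mul_assoc, ← (hcomm r hr).eq, mul_assoc, hmulP r hr]
      have h2 : D.A z s (p r f) = p r (D.A z s (P f)) :=
        congrArg (fun T : K →L[ℂ] K => T f) h1
      rw [h2, hu, map_zero]
    rw [hP, sum_apply]
    exact Finset.sum_eq_zero h0
  have hdiss : ∀ u ∈ LinearMap.range (P : K →ₗ[ℂ] K), u ≠ 0 →
      0 < (inner ℂ u (D.J (N u))).im := by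
    intro u hu hu0
    have hPu : P u = u := by
      obtain ⟨f, rfl⟩ := hu
      exact congrArg (fun T : K →L[ℂ] K => T f) hPP
    have h1 : N u = (z.im : ℂ) • D.T z s (D.J u) := by
      rw [hN]
      change (z.im : ℂ) • D.T z s (D.J (P u)) = _
      rw [hPu]
    -- Positivity is applied to $\varphi=Ju$, for which $T_z(H_s)\varphi=A_z(s)u\ne0$.
    have h2 := hD.im_inner_T_pos hz s (φ := D.J u) fun h => hu0 (hinj u hu h)
    rw [h1, map_smul, inner_smul_right, Complex.im_ofReal_mul]
    have h3 : inner ℂ (D.J u) (D.T z s (D.J u)) = inner ℂ u (D.J (D.T z s (D.J u))) :=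
      hD.selfAdjoint_J.isSymmetric u _
    rwa [h3] at h2
  refine ⟨⟨?_, ?_⟩, ?_, ?_⟩
  · rw [hM]; exact hfin.mul_left _
  · rw [hM]; exact hD.selfAdjoint_J.conjugate' P
  · exact ResonanceIndex.isClassR_of_dissipative hD.selfAdjoint_J hfin hPN hdiss
  · rw [hM]
    exact ResonanceIndex.signature_eq_rIndex hD.selfAdjoint_J hfin hPP hPN hdiss
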